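/- Let $X$ be a compact metric space, $r:X\to X$ a Borel measurable, surjective, finite-to-one map, and $\mu$ a Borel probability measure on $X$ that is strongly invariant: $$\int f\,d\mu=\int \frac{1}{\#r^{-1}(x)}\sum_{r(y)=x}f(y)\,d\mu(x)$$ for every bounded Borel function $f$. Let $m_0:X\to\mathbb C$ be a Borel measurable quadrature mirror filter, i.e. $\frac1{\#r^{-1}(x)}\sum_{r(y)=x}|m_0(y)|^2=1$ for all $x\in X$, and put $W(x)=|m_0(x)|^2/\#r^{-1}(r(x))$. Let $X_\infty=\{(x_0,x_1,\dots)\in X^{\mathbb N}: r(x_{n+1})=x_n \text{ for all } n\ge 0\}$, with the $\sigma$-algebra generated by the coordinates, let $\theta_0(x_0,x_1,\dots)=x_0$ and $r_\infty(x_0,x_1,\dots)=(r(x_0),x_0,x_1,\dots)$. For $x\in X$ let $P_x$ be the law on $X_\infty$ of the random walk that starts at $x_0=x$ and moves from $x_n$ to $x_{n+1}=y\in r^{-1}(x_n)$ with probability $W(y)$, and let $\mu_\infty=\int_X P_x\,d\mu(x)$. The wavelet representation $[\mathcal H,U,\pi]$ associated to $m_0$ is $\mathcal H=L^2(X_\infty,\mu_\infty)$,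 $U\xi=(m_0\circ\theta_0)\,(\xi\circ r_\infty)$, $\pi(f)\xi=(f\circ\theta_0)\,\xi$ for $f\in L^\infty(X,\mu)$. For $z\in X_\infty$ such that $m_0(\theta_0(r_\infty^n z))\neq 0$ for all $n\in\mathbb Z$, put $\tilde m_n(z)=\prod_{k=0}^{n-1}m_0(\theta_0(r_\infty^k z))$ for $n\ge 0$ and $\tilde m_{n}(z)=\prod_{k=1}^{-n}m_0(\theta_0(r_\infty^{-k} z))^{-1}$ for $n<0$. Let $\mathcal H_z$ be the Hilbert space of all sequences $\xi:\mathbb Z\to\mathbb C$ with $\sum_{n\in\mathbb Z}|\xi_n|^2|\tilde m_n(z)|^2<\infty$, with inner product $\langle\xi,\eta\rangle=\sum_n\xi_n\overline{\eta_n}|\tilde m_n(z)|^2$, and let $$(U_z\xi)_n=m_0(\theta_0(r_\infty^n z))\,\xi_{n+1},\qquad (\pi_z(f)\xi)_n=f(\theta_0(r_\infty^n z))\,\xi_n$$ for bounded Borel functions $f$ on $X$. The spaces $\mathcal H_z$ form a measurable field, in which a section is measurable iff all its coordinates are. Theorem. Suppose that $r$ is ergodic with respect to $\mu$, that $\mu(\{m_0=0\})=0$,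 that $|m_0|$ is not equal to $1$ $\mu$-a.e., and that $\log|m_0|^2\in L^1(X,\mu)$. Then there is a measurable set $\mathcal F\subseteq X_\infty$ that is a fundamental domain for $r_\infty$, i.e., up to $\mu_\infty$-null sets, $\bigcup_{n\in\mathbb Z}r_\infty^n(\mathcal F)=X_\infty$ and $r_\infty^n(\mathcal F)\cap r_\infty^m(\mathcal F)=\emptyset$ for $n\ne m$, such that $$[\mathcal H,U,\pi]=\int_{\mathcal F}^{\oplus}[\mathcal H_z,U_z,\pi_z]\,d\mu_\infty(z),$$ i.e. there is a unitary from $L^2(X_\infty,\mu_\infty)$ onto the direct integral $\int_{\mathcal F}^\oplus\mathcal H_z\,d\mu_\infty(z)$ that carries $U$ to $\int^\oplus_{\mathcal F} U_z\,d\mu_\infty(z)$ and, for every bounded Borel function $f$, $\pi(f)$ to $\int_{\mathcal F}^\oplus\pi_z(f)\,d\mu_\infty(z)$. Moreover, for $\mu_\infty$-a.e. $z\in\mathcal F$ the representation $[\mathcal H_z,U_z,\pi_z]$ is defined and irreducible: $\mathcal H_z\neq 0$, and $0$ and $\mathcal H_z$ are its only closed subspaces invariant under $U_z$, $U_z^{-1}$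 and all $\pi_z(f)$. -/

import Mathlib

open MeasureTheory ProbabilityTheory
open scoped ENNReal

noncomputable section

/-! ### Hilbert spaces of weighted square-summable two-sided sequences -/

/-- The sequences `ξ : ℤ → ℂ` with `∑ |ξ n|² |w n|² < ∞`. -/
def weightedL2Submodule (w : ℤ → ℂˣ) : Submodule ℂ (ℤ → ℂ) where
  carrier := {ξ | Summable fun n => ‖ξ n‖ ^ 2 * ‖(w n : ℂ)‖ ^ 2}
  zero_mem' := by simp [summable_zero]
  add_mem' := by
    intro ξ η hξ hη
    refine Summable.of_nonneg_of_le (fun n => by positivity) (fun n => ?_)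
      ((hξ.mul_left 2).add (hη.mul_left 2))
    have h1 : ‖ξ n + η n‖ ≤ ‖ξ n‖ + ‖η n‖ := norm_add_le _ _
    have h2 : ‖ξ n + η n‖ ^ 2 ≤ 2 * ‖ξ n‖ ^ 2 + 2 * ‖η n‖ ^ 2 := by
      nlinarith [norm_nonneg (ξ n + η n), sq_nonneg (‖ξ n‖ - ‖η n‖)]
    have h3 : 0 ≤ ‖(w n : ℂ)‖ ^ 2 := by positivity
    simp only [Pi.add_apply]
    nlinarith [mul_le_mul_of_nonneg_right h2 h3]
  smul_mem' := by
    intro c ξ hξ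
    refine (Summable.mul_left (‖c‖ ^ 2) hξ).congr (fun n => ?_)
    simp [mul_pow, mul_assoc]

/-- The weighted `ℓ²(ℤ)`-space with weights `|w n|²`. -/
def WeightedL2 (w : ℤ → ℂˣ) : Type := weightedL2Submodule w

namespace WeightedL2

variable {w : ℤ → ℂˣ}

instance : AddCommGroup (WeightedL2 w) :=
  inferInstanceAs (AddCommGroup (weightedL2Submodule w))

instance : Module ℂ (WeightedL2 w) :=
  inferInstanceAs (Module ℂ (weightedL2Submodule w))

instance : CoeFun (WeightedL2 w) (fun _ => ℤ → ℂ) := ⟨fun ξ => ξ.1⟩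

/-- A square-summable sequence as an element of the weighted space. -/
def mk (ξ : ℤ → ℂ) (h : Summable fun n => ‖ξ n‖ ^ 2 * ‖(w n : ℂ)‖ ^ 2) : WeightedL2 w := ⟨ξ, h⟩

@[simp] theorem mk_apply (ξ : ℤ → ℂ) (h : Summable fun n => ‖ξ n‖ ^ 2 * ‖(w n : ℂ)‖ ^ 2)
    (n : ℤ) : (mk ξ h : WeightedL2 w) n = ξ n := rfl

theorem ext {ξ η : WeightedL2 w} (h : ∀ n, ξ n = η n) : ξ = η := Subtype.ext (funext h)

theorem summable (ξ : WeightedL2 w) : Summable fun n => ‖ξ n‖ ^ 2 * ‖(w n : ℂ)‖ ^ 2 := ξ.2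

@[simp] theorem add_apply (ξ η : WeightedL2 w) (n : ℤ) : (ξ + η) n = ξ n + η n := rfl

@[simp] theorem smul_apply (c : ℂ) (ξ : WeightedL2 w) (n : ℤ) : (c • ξ) n = c * ξ n := rfl

@[simp] theorem zero_apply (n : ℤ) : (0 : WeightedL2 w) n = 0 := rfl

/-- Multiplication by the weights, onto the unweighted `ℓ²(ℤ)`. -/
def toLp (w : ℤ → ℂˣ) : WeightedL2 w ≃ₗ[ℂ] lp (fun _ : ℤ => ℂ) 2 where
  toFun ξ := ⟨fun n => (w n : ℂ) * ξ n, by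
    refine memℓp_gen (ξ.summable.congr fun n => ?_)
    simp [mul_pow, mul_comm]⟩
  map_add' ξ η := by ext n; exact mul_add _ _ _
  map_smul' c ξ := by ext n; exact mul_left_comm _ _ _
  invFun x := mk (fun n => ((w n)⁻¹ : ℂˣ) * x n) (by
    refine ((lp.memℓp x).summable (by norm_num)).congr fun n => ?_
    have : ‖(w n : ℂ)‖ ≠ 0 := by simp
    simp [mul_pow]
    field_simp)
  left_inv ξ := by apply ext; intro n; simp
  right_inv x := by ext n; simp

theorem toLp_apply (ξ : WeightedL2 w) (n : ℤ) :
    (toLp w ξ : ℤ → ℂ) n = (w n : ℂ) * ξ n := rfl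

instance : NormedAddCommGroup (WeightedL2 w) :=
  NormedAddCommGroup.induced _ _ (toLp w) (toLp w).injective

theorem norm_def (ξ : WeightedL2 w) : ‖ξ‖ = ‖toLp w ξ‖ := rfl

theorem term_eq (ξ η : WeightedL2 w) (n : ℤ) :
    inner ℂ ((toLp w ξ : ℤ → ℂ) n) ((toLp w η : ℤ → ℂ) n)
      = starRingEnd ℂ (ξ n) * η n * (‖(w n : ℂ)‖ ^ 2 : ℝ) := by
  have h : (starRingEnd ℂ (w n : ℂ)) * (w n : ℂ) = ((‖(w n : ℂ)‖ ^ 2 : ℝ) : ℂ) := by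
    rw [mul_comm, Complex.mul_conj, Complex.normSq_eq_norm_sq]
  rw [toLp_apply, toLp_apply, RCLike.inner_apply', map_mul, ← h]
  ring

/-- The inner product is `∑ conj (ξ n) * η n * |w n|²` (conjugate-linear in the first entry). -/
instance : InnerProductSpace ℂ (WeightedL2 w) where
  norm_smul_le c ξ := by
    rw [norm_def, norm_def, map_smul]; exact norm_smul_le _ _
  inner ξ η := ∑' n, starRingEnd ℂ (ξ n) * η n * (‖(w n : ℂ)‖ ^ 2 : ℝ)
  norm_sq_eq_re_inner ξ := by
    rw [norm_def, InnerProductSpace.norm_sq_eq_re_inner (𝕜 := ℂ), lp.inner_eq_tsum]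
    simp only [term_eq]
  conj_inner_symm ξ η := by
    have := InnerProductSpace.conj_inner_symm (𝕜 := ℂ) (toLp w ξ) (toLp w η)
    rw [lp.inner_eq_tsum, lp.inner_eq_tsum] at this
    simpa only [term_eq] using this
  add_left ξ η ζ := by
    have := InnerProductSpace.add_left (𝕜 := ℂ) (toLp w ξ) (toLp w η) (toLp w ζ)
    rw [← map_add, lp.inner_eq_tsum, lp.inner_eq_tsum, lp.inner_eq_tsum] at this
    simpa only [term_eq] using this
  smul_left ξ η c := by
    have := InnerProductSpace.smul_left (𝕜 := ℂ) (toLp w ξ) (toLp w η) c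
    rw [← map_smul, lp.inner_eq_tsum, lp.inner_eq_tsum] at this
    simpa only [term_eq] using this

theorem inner_def (ξ η : WeightedL2 w) :
    inner ℂ ξ η = ∑' n, starRingEnd ℂ (ξ n) * η n * (‖(w n : ℂ)‖ ^ 2 : ℝ) := rfl

theorem norm_sq_eq (ξ : WeightedL2 w) : ‖ξ‖ ^ 2 = ∑' n, ‖ξ n‖ ^ 2 * ‖(w n : ℂ)‖ ^ 2 := by
  rw [norm_def, lp.norm_eq_tsum_rpow (by norm_num), ← Real.rpow_natCast, ← Real.rpow_mul
    (tsum_nonneg fun n => by positivity)]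
  simp [toLp_apply, mul_pow, mul_comm]

/-- `toLp` as an isometry. -/
def toLpIso (w : ℤ → ℂˣ) : WeightedL2 w ≃ₗᵢ[ℂ] lp (fun _ : ℤ => ℂ) 2 :=
  { toLp w with norm_map' := fun _ => rfl }

instance : CompleteSpace (WeightedL2 w) := (toLpIso w).toIsometryEquiv.completeSpace

/-- The sequence that is `1` at `n` and `0` elsewhere. -/
def delta (n : ℤ) : WeightedL2 w :=
  mk (Pi.single n 1) (summable_of_ne_finset_zero (s := {n}) (by
    intro m hm
    have : m ≠ n := by simpa using hm
    simp [this]))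

theorem inner_delta (n : ℤ) (ξ : WeightedL2 w) :
    inner ℂ (delta n) ξ = ξ n * (‖(w n : ℂ)‖ ^ 2 : ℝ) := by
  rw [inner_def, tsum_eq_single n]
  · simp [delta]
  · intro m hm
    simp [delta, hm]

theorem span_delta_dense :
    (Submodule.span ℂ (Set.range (delta (w := w)))).topologicalClosure = ⊤ := by
  rw [Submodule.topologicalClosure_eq_top_iff, Submodule.eq_bot_iff]
  intro ξ hξ
  apply ext
  intro n
  have h := (Submodule.mem_orthogonal _ _).1 hξ (delta n) (Submodule.subset_span ⟨n, rfl⟩)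
  rw [inner_delta] at h
  simpa using h

end WeightedL2

/-! ### Direct integrals of Hilbert spaces -/

/-- A measurable field of Hilbert spaces: a family of Hilbert spaces `H z` with a distinguished
space of measurable sections. -/
structure MeasurableField {Z : Type*} [MeasurableSpace Z] (H : Z → Type*)
    [∀ z, NormedAddCommGroup (H z)] [∀ z, InnerProductSpace ℂ (H z)]
    [∀ z, CompleteSpace (H z)] where
  sections : Submodule ℂ (∀ z, H z)
  measurable_norm : ∀ ξ ∈ sections, Measurable fun z => ‖ξ z‖
  mem_of_measurable_inner : ∀ η : ∀ z, H z,
    (∀ ξ ∈ sections, Measurable fun z => inner ℂ (ξ z) (η z)) → η ∈ sections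
  exists_total : ∃ e : ℕ → ∀ z, H z, (∀ n, e n ∈ sections) ∧
    ∀ z, (Submodule.span ℂ (Set.range fun n => e n z)).topologicalClosure = ⊤

namespace MeasurableField

variable {Z : Type*} [MeasurableSpace Z] {H : Z → Type*}
  [∀ z, NormedAddCommGroup (H z)] [∀ z, InnerProductSpace ℂ (H z)] [∀ z, CompleteSpace (H z)]
  (M : MeasurableField H) (ν : Measure Z)

/-- The square-integrable measurable sections. -/
def l2Submodule : Submodule ℂ (∀ z, H z) where
  carrier := {ξ | ξ ∈ M.sections ∧ Integrable (fun z => ‖ξ z‖ ^ 2) ν}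
  zero_mem' := ⟨M.sections.zero_mem, by simp⟩
  add_mem' := by
    rintro ξ η ⟨hξ, hξ'⟩ ⟨hη, hη'⟩
    refine ⟨M.sections.add_mem hξ hη, ?_⟩
    refine ((hξ'.const_mul 2).add (hη'.const_mul 2)).mono'
      ((M.measurable_norm _ (M.sections.add_mem hξ hη)).pow_const 2).aestronglyMeasurable
      (Filter.Eventually.of_forall fun z => ?_)
    have h1 : ‖ξ z + η z‖ ≤ ‖ξ z‖ + ‖η z‖ := norm_add_le _ _
    rw [Real.norm_of_nonneg (by positivity)]
    simp only [Pi.add_apply]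
    nlinarith [norm_nonneg (ξ z + η z), sq_nonneg (‖ξ z‖ - ‖η z‖)]
  smul_mem' := by
    rintro c ξ ⟨hξ, hξ'⟩
    refine ⟨M.sections.smul_mem c hξ, ?_⟩
    simpa [norm_smul, mul_pow] using hξ'.const_mul (‖c‖ ^ 2)

/-- The space of square-integrable measurable sections, before a.e. equal sections are
identified. -/
def L2Section : Type _ := M.l2Submodule ν

namespace L2Section

variable {M ν}

instance : AddCommGroup (L2Section M ν) := inferInstanceAs (AddCommGroup (M.l2Submodule ν))

instance : Module ℂ (L2Section M ν) := inferInstanceAs (Module ℂ (M.l2Submodule ν))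

instance : CoeFun (L2Section M ν) (fun _ => ∀ z, H z) := ⟨fun ξ => ξ.1⟩

@[simp] theorem add_apply (ξ η : L2Section M ν) (z : Z) : (ξ + η) z = ξ z + η z := rfl

@[simp] theorem sub_apply (ξ η : L2Section M ν) (z : Z) : (ξ - η) z = ξ z - η z := rfl

@[simp] theorem smul_apply (c : ℂ) (ξ : L2Section M ν) (z : Z) : (c • ξ) z = c • ξ z := rfl

theorem measurable_norm (ξ : L2Section M ν) : Measurable fun z => ‖ξ z‖ :=
  M.measurable_norm _ ξ.2.1

theorem measurable_inner (ξ η : L2Section M ν) : Measurable fun z => inner ℂ (ξ z) (η z) := by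
  have h (c : ℂ) : Measurable fun z => ‖ξ z + c • η z‖ :=
    M.measurable_norm _ (M.sections.add_mem ξ.2.1 (M.sections.smul_mem c η.2.1))
  have h1 := h 1
  have h2 := h (-1)
  have h3 := h Complex.I
  have h4 := h (-Complex.I)
  simp only [one_smul, neg_smul, ← sub_eq_add_neg] at h1 h2 h3 h4
  simp only [inner_eq_sum_norm_sq_div_four, RCLike.I_to_complex]
  fun_prop

theorem integrable_inner (ξ η : L2Section M ν) :
    Integrable (fun z => inner ℂ (ξ z) (η z)) ν := by
  refine (ξ.2.2.add η.2.2).mono' (measurable_inner ξ η).aestronglyMeasurable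
    (Filter.Eventually.of_forall fun z => ?_)
  have := norm_inner_le_norm (𝕜 := ℂ) (ξ z) (η z)
  have h1 := norm_nonneg (ξ z)
  have h2 := norm_nonneg (η z)
  simp only [Pi.add_apply]
  nlinarith [sq_nonneg (‖ξ z‖ - ‖η z‖)]

/-- The semi-inner product `∫ ⟪ξ z, η z⟫ dν(z)`. -/
@[reducible]
def core : PreInnerProductSpace.Core ℂ (L2Section M ν) where
  inner ξ η := ∫ z, inner ℂ (ξ z) (η z) ∂ν
  conj_inner_symm ξ η := by
    rw [← integral_conj]
    simp only [inner_conj_symm]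
  re_inner_nonneg ξ := by
    simp only [inner_self_eq_norm_sq_to_K]
    have : (∫ z, ((‖ξ z‖ : ℂ)) ^ 2 ∂ν) = ((∫ z, ‖ξ z‖ ^ 2 ∂ν : ℝ) : ℂ) := by
      rw [← integral_complex_ofReal]; simp
    erw [this]
    simpa using integral_nonneg fun z => sq_nonneg ‖ξ z‖
  add_left ξ η ζ := by
    simp only [add_apply, inner_add_left]
    exact integral_add (integrable_inner ξ ζ) (integrable_inner η ζ)
  smul_left ξ η c := by
    simp only [smul_apply, inner_smul_left]
    exact integral_const_mul _ _

instance : SeminormedAddCommGroup (L2Section M ν) :=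
  InnerProductSpace.Core.toSeminormedAddCommGroup (c := core)

instance : InnerProductSpace ℂ (L2Section M ν) := InnerProductSpace.ofCore core

theorem inner_def (ξ η : L2Section M ν) : inner ℂ ξ η = ∫ z, inner ℂ (ξ z) (η z) ∂ν := rfl

end L2Section

/-- The direct integral `∫^⊕ H z dν(z)`: square-integrable measurable sections modulo sections
of norm zero. -/
abbrev DirectIntegral : Type _ := SeparationQuotient (L2Section M ν)

/-- The class of a square-integrable section in the direct integral. -/
abbrev DirectIntegral.mk (ξ : L2Section M ν) : DirectIntegral M ν := SeparationQuotient.mk ξ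

/-- Two sections define the same vector of the direct integral iff they agree a.e. -/
theorem DirectIntegral.mk_eq_mk (ξ η : L2Section M ν) :
    DirectIntegral.mk M ν ξ = DirectIntegral.mk M ν η ↔ ∀ᵐ z ∂ν, ξ z = η z := by
  rw [SeparationQuotient.mk_eq_mk, Metric.inseparable_iff, dist_eq_norm,
    ← sq_eq_zero_iff, InnerProductSpace.norm_sq_eq_re_inner (𝕜 := ℂ), L2Section.inner_def]
  have h : (∫ z, inner ℂ ((ξ - η) z) ((ξ - η) z) ∂ν)
      = ((∫ z, ‖(ξ - η) z‖ ^ 2 ∂ν : ℝ) : ℂ) := by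
    rw [← integral_complex_ofReal]
    simp [inner_self_eq_norm_sq_to_K]
  erw [h, RCLike.ofReal_re]
  rw [integral_eq_zero_iff_of_nonneg (fun z => sq_nonneg _) (ξ - η).2.2]
  refine Filter.eventually_congr (Filter.Eventually.of_forall fun z => ?_)
  simp [sub_eq_zero]

/-- `T = ∫^⊕ t z dν(z)`: the operator `T` on the direct integral acts on sections fibrewise,
through the operators `t z`. -/
def IsFibrewise (T : DirectIntegral M ν → DirectIntegral M ν) (t : ∀ z, H z → H z) : Prop :=
  ∀ ξ : L2Section M ν, ∃ η : L2Section M ν,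
    (∀ᵐ z ∂ν, η z = t z (ξ z)) ∧ T (DirectIntegral.mk M ν ξ) = DirectIntegral.mk M ν η

end MeasurableField

/-! ### Covariant representations -/

/-- The `*`-algebra of bounded measurable functions on `X`. -/
def BoundedBorel (X : Type*) [MeasurableSpace X] : StarSubalgebra ℂ (X → ℂ) where
  carrier := {f | Measurable f ∧ ∃ C : ℝ, ∀ x, ‖f x‖ ≤ C}
  mul_mem' := by
    rintro f g ⟨hf, C, hC⟩ ⟨hg, D, hD⟩
    refine ⟨hf.mul hg, C * D, fun x => ?_⟩
    simp only [Pi.mul_apply, norm_mul]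
    exact mul_le_mul (hC x) (hD x) (norm_nonneg _) ((norm_nonneg _).trans (hC x))
  add_mem' := by
    rintro f g ⟨hf, C, hC⟩ ⟨hg, D, hD⟩
    exact ⟨hf.add hg, C + D, fun x => (norm_add_le _ _).trans (add_le_add (hC x) (hD x))⟩
  algebraMap_mem' c := ⟨measurable_const, ‖c‖, fun _ => le_rfl⟩
  star_mem' := by
    rintro f ⟨hf, C, hC⟩
    exact ⟨Complex.continuous_conj.measurable.comp hf, C, fun x => by simpa using hC x⟩

namespace BoundedBorel

variable {X : Type*} [MeasurableSpace X]

/-- Composition with a measurable map. -/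
def comp (f : BoundedBorel X) (r : X → X) (hr : Measurable r) : BoundedBorel X :=
  ⟨fun x => (f : X → ℂ) (r x), f.2.1.comp hr, f.2.2.imp fun _ h x => h (r x)⟩

end BoundedBorel

/-- A covariant representation `[H, U, π]` of `(X, r)`: a unitary `U` and a `*`-representation `π`
of the bounded measurable functions with `U π(f) U⁻¹ = π(f ∘ r)`. -/
structure CovariantRep {X : Type*} [MeasurableSpace X] (r : X → X) (hr : Measurable r)
    (H : Type*) [NormedAddCommGroup H] [InnerProductSpace ℂ H] [CompleteSpace H] where
  U : H ≃ₗᵢ[ℂ] H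
  π : BoundedBorel X →⋆ₐ[ℂ] (H →L[ℂ] H)
  covariance : ∀ (f : BoundedBorel X) (ξ : H), U (π f (U.symm ξ)) = π (BoundedBorel.comp f r hr) ξ

/-- Irreducibility: the space is nonzero, and its only closed subspaces that are invariant under
`U`, `U⁻¹` and all `π f` are `0` and the whole space. -/
def CovariantRep.Irreducible {X : Type*} [MeasurableSpace X] {r : X → X} {hr : Measurable r}
    {H : Type*} [NormedAddCommGroup H] [InnerProductSpace ℂ H] [CompleteSpace H]
    (R : CovariantRep r hr H) : Prop :=
  Nontrivial H ∧ ∀ K : Submodule ℂ H, IsClosed (K : Set H) →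
    (∀ ξ ∈ K, R.U ξ ∈ K) → (∀ ξ ∈ K, R.U.symm ξ ∈ K) → (∀ f, ∀ ξ ∈ K, R.π f ξ ∈ K) →
    K = ⊥ ∨ K = ⊤

/-! ### The data, the solenoid and its measure -/

/-- A finite-to-one measurable map `r` of `X` onto `X`, a strongly invariant probability measure
`μ` and a quadrature mirror filter `m0`. -/
structure FilterSystem (X : Type*) [MeasurableSpace X] where
  r : X → X
  measurable_r : Measurable r
  surjective_r : Function.Surjective r
  finite_fiber : ∀ x, (r ⁻¹' {x}).Finite
  μ : Measure X
  isProbabilityMeasure : IsProbabilityMeasure μ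
  strongly_invariant : ∀ f : X → ℂ, Measurable f → (∃ C : ℝ, ∀ x, ‖f x‖ ≤ C) →
    ∫ x, f x ∂μ =
      ∫ x, (1 / ((r ⁻¹' {x}).ncard : ℂ)) * ∑ y ∈ (finite_fiber x).toFinset, f y ∂μ
  m0 : X → ℂ
  measurable_m0 : Measurable m0
  qmf : ∀ x, (1 / ((r ⁻¹' {x}).ncard : ℝ)) * ∑ y ∈ (finite_fiber x).toFinset, ‖m0 y‖ ^ 2 = 1

/-- A copy of `X` with the discrete `σ`-algebra. -/
structure DiscreteCopy (X : Type*) where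
  val : X

instance (X : Type*) : MeasurableSpace (DiscreteCopy X) := ⊤

namespace FilterSystem

variable {X : Type*} [MeasurableSpace X] (S : FilterSystem X)

/-- The fibre `r⁻¹(x)` as a finite set. -/
def fiber (x : X) : Finset X := (S.finite_fiber x).toFinset

theorem mem_fiber {x y : X} : y ∈ S.fiber x ↔ S.r y = x := by simp [fiber]

/-- `W(x) = |m₀(x)|² / #r⁻¹(r(x))`. -/
def W (x : X) : ℝ := ‖S.m0 x‖ ^ 2 / ((S.r ⁻¹' {S.r x}).ncard : ℝ)

theorem W_nonneg (x : X) : 0 ≤ S.W x := by unfold W; positivity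

theorem sum_W (x : X) : ∑ y ∈ S.fiber x, S.W y = 1 := by
  rw [← S.qmf x, Finset.mul_sum]
  refine Finset.sum_congr rfl fun y hy => ?_
  rw [W, S.mem_fiber.1 hy]
  ring

/-- One step of the random walk: from `x` to `y ∈ r⁻¹(x)` with probability `W(y)`. -/
def step (x : X) : Measure (DiscreteCopy X) :=
  ∑ y ∈ S.fiber x, ENNReal.ofReal (S.W y) • Measure.dirac (DiscreteCopy.mk y)

/-- The steps as Markov kernels that depend on the last point of the path only. -/
def stepKernel (n : ℕ) : Kernel ((i : Finset.Iic n) → DiscreteCopy X) (DiscreteCopy X) :=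
  Kernel.comap (⟨fun x => S.step x.val, measurable_from_top⟩ :
      Kernel (DiscreteCopy X) (DiscreteCopy X))
    (fun p => p ⟨n, Finset.mem_Iic.2 le_rfl⟩) (measurable_pi_apply _)

instance (n : ℕ) : IsMarkovKernel (S.stepKernel n) := by
  refine ⟨fun p => ⟨?_⟩⟩
  change (S.step _) Set.univ = 1
  simp only [step, Measure.coe_finsetSum, Finset.sum_apply, Measure.smul_apply, measure_univ,
    smul_eq_mul, mul_one]
  rw [← ENNReal.ofReal_sum_of_nonneg fun y _ => S.W_nonneg y, S.sum_W, ENNReal.ofReal_one]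

/-- The solenoid `X_∞ = {(x₀, x₁, …) | r(x_{n+1}) = x_n}`; its `σ`-algebra is generated by the
coordinates. -/
def Solenoid : Type _ := {x : ℕ → X // ∀ n, S.r (x (n + 1)) = x n}

instance : MeasurableSpace S.Solenoid :=
  inferInstanceAs (MeasurableSpace {x : ℕ → X // ∀ n, S.r (x (n + 1)) = x n})

/-- The projection `θ₀ (x₀, x₁, …) = x₀`. -/
def θ₀ (z : S.Solenoid) : X := z.1 0

/-- The automorphism `r_∞ (x₀, x₁, …) = (r(x₀), x₀, x₁, …)`. -/
def rInf : Equiv.Perm S.Solenoid where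
  toFun z := ⟨fun n => Nat.casesOn n (S.r (z.1 0)) (fun k => z.1 k), by
    intro n
    cases n with
    | zero => rfl
    | succ k => exact z.2 k⟩
  invFun z := ⟨fun n => z.1 (n + 1), fun n => z.2 (n + 1)⟩
  left_inv z := rfl
  right_inv z := by
    refine Subtype.ext (funext fun n => ?_)
    cases n with
    | zero => exact z.2 0
    | succ k => rfl

/-- The path measure `P_x`, the law on the solenoid of the random walk `x, x₁, x₂, …` that starts
at `x`. It is built by the Ionescu-Tulcea theorem over the discrete `σ`-algebra of `X`. -/
def pathMeasure (x : X) : Measure S.Solenoid :=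
  ((Kernel.traj (X := fun _ => DiscreteCopy X) S.stepKernel 0 (fun _ => DiscreteCopy.mk x)).map
    (fun (p : ℕ → DiscreteCopy X) (n : ℕ) => (p n).val)).comap Subtype.val

/-- The measure `μ_∞ = ∫ P_x dμ(x)` on the solenoid. -/
def μInf : Measure S.Solenoid := S.μ.bind S.pathMeasure

/-! ### The cocycle and the component representations -/

/-- `a_n(z) = θ₀ (r_∞^n z)`. -/
def orbit (z : S.Solenoid) (n : ℤ) : X := S.θ₀ ((S.rInf ^ n) z)

theorem orbit_succ (z : S.Solenoid) (n : ℤ) : S.orbit z (n + 1) = S.r (S.orbit z n) := by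
  rw [orbit, add_comm, zpow_add, zpow_one]; rfl

theorem measurable_rInf : Measurable S.rInf := by
  refine Measurable.subtype_mk (measurable_pi_lambda _ fun n => ?_)
  cases n with
  | zero => exact S.measurable_r.comp ((measurable_pi_apply 0).comp measurable_subtype_coe)
  | succ k => exact (measurable_pi_apply k).comp measurable_subtype_coe

theorem measurable_rInf_symm : Measurable S.rInf.symm := by
  refine Measurable.subtype_mk (measurable_pi_lambda _ fun n => ?_)
  exact (measurable_pi_apply (n + 1)).comp measurable_subtype_coe

theorem measurable_rInf_zpow (n : ℤ) : Measurable (S.rInf ^ n : Equiv.Perm S.Solenoid) := by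
  have h (f : Equiv.Perm S.Solenoid) (hf : Measurable f) (k : ℕ) :
      Measurable (f ^ k : Equiv.Perm S.Solenoid) := by
    rw [Equiv.Perm.coe_pow]
    exact hf.iterate k
  cases n with
  | ofNat k => exact h _ S.measurable_rInf k
  | negSucc k =>
    rw [zpow_negSucc, ← inv_pow]
    exact h _ S.measurable_rInf_symm (k + 1)

theorem measurable_orbit (n : ℤ) : Measurable fun z => S.orbit z n :=
  (((measurable_pi_apply 0).comp measurable_subtype_coe).comp (S.measurable_rInf_zpow n) :)

/-- The cocycle: `m̃_n = ∏_{0 ≤ k < n} m₀ ∘ θ₀ ∘ r_∞^k` for `n ≥ 0` and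
`m̃_{-n} = 1 / ∏_{1 ≤ k ≤ n} m₀ ∘ θ₀ ∘ r_∞^{-k}`. -/
def mTilde (z : S.Solenoid) : ℤ → ℂ
  | Int.ofNat n => ∏ k ∈ Finset.range n, S.m0 (S.orbit z (k : ℤ))
  | Int.negSucc n => (∏ k ∈ Finset.range (n + 1), S.m0 (S.orbit z (-((k : ℤ) + 1))))⁻¹

theorem measurable_mTilde (n : ℤ) : Measurable fun z => S.mTilde z n := by
  have h (j : ℤ) : Measurable fun z => S.m0 (S.orbit z j) :=
    S.measurable_m0.comp (S.measurable_orbit j)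
  cases n with
  | ofNat n => exact Finset.measurable_fun_prod _ fun k _ => h _
  | negSucc n => exact (Finset.measurable_fun_prod _ fun k _ => h _).inv

/-- The points of the solenoid on whose `r_∞`-orbit `m₀ ∘ θ₀` has no zero. -/
def regularSet : Set S.Solenoid := {z | ∀ n : ℤ, S.m0 (S.orbit z n) ≠ 0}

/-- At such a point the values `m̃_n(z)` are nonzero. -/
def mTildeUnit (z : S.regularSet) (n : ℤ) : ℂˣ :=
  Units.mk0 (S.mTilde z n) (by
    cases n with
    | ofNat n => exact Finset.prod_ne_zero_iff.2 fun k _ => z.2 _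
    | negSucc n => exact inv_ne_zero (Finset.prod_ne_zero_iff.2 fun k _ => z.2 _))

theorem mTilde_succ (z : S.regularSet) (n : ℤ) :
    S.mTilde z (n + 1) = S.mTilde z n * S.m0 (S.orbit z n) := by
  cases n with
  | ofNat n => exact Finset.prod_range_succ _ _
  | negSucc n =>
    have h0 := z.2 (Int.negSucc n)
    have e : Int.negSucc n = -((n : ℤ) + 1) := rfl
    cases n with
    | zero =>
      change ∏ k ∈ Finset.range 0, S.m0 (S.orbit z (k : ℤ)) = _
      simp only [mTilde]
      rw [e] at h0 ⊢
      simp at h0 ⊢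
      rw [inv_mul_cancel₀ h0]
    | succ n =>
      change (∏ k ∈ Finset.range (n + 1), S.m0 (S.orbit z (-((k : ℤ) + 1))))⁻¹ =
        (∏ k ∈ Finset.range (n + 1 + 1), S.m0 (S.orbit z (-((k : ℤ) + 1))))⁻¹ * _
      rw [Finset.prod_range_succ _ (n + 1), mul_inv, mul_assoc]
      rw [e] at h0 ⊢
      rw [inv_mul_cancel₀ h0, mul_one]

/-- The component space `H_z`. -/
abbrev compSpace (z : S.regularSet) : Type := WeightedL2 (S.mTildeUnit z)

theorem norm_mTildeUnit_succ (z : S.regularSet) (n : ℤ) :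
    ‖(S.mTildeUnit z (n + 1) : ℂ)‖ = ‖(S.mTildeUnit z n : ℂ)‖ * ‖S.m0 (S.orbit z n)‖ := by
  simp only [mTildeUnit, Units.val_mk0, mTilde_succ, norm_mul]

/-- `(U_z ξ)_n = m₀(θ₀(r_∞^n z)) ξ_{n+1}`, as a linear bijection. -/
def compULin (z : S.regularSet) : S.compSpace z ≃ₗ[ℂ] S.compSpace z where
  toFun ξ := WeightedL2.mk (fun n => S.m0 (S.orbit z n) * ξ (n + 1)) (by
    refine (ξ.summable.comp_injective (add_left_injective (1 : ℤ))).congr fun n => ?_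
    simp only [Function.comp, norm_mTildeUnit_succ, norm_mul]
    ring)
  map_add' ξ η := by apply WeightedL2.ext; intro n; exact mul_add _ _ _
  map_smul' c ξ := by apply WeightedL2.ext; intro n; exact mul_left_comm _ _ _
  invFun ξ := WeightedL2.mk (fun n => (S.m0 (S.orbit z (n - 1)))⁻¹ * ξ (n - 1)) (by
    refine (ξ.summable.comp_injective (sub_left_injective (b := (1 : ℤ)))).congr fun n => ?_
    have h0 : ‖S.m0 (S.orbit z (n - 1))‖ ≠ 0 := norm_ne_zero_iff.2 (z.2 _)
    have h1 := S.norm_mTildeUnit_succ z (n - 1)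
    rw [sub_add_cancel] at h1
    simp only [Function.comp, h1, norm_mul, norm_inv]
    field_simp)
  left_inv ξ := by
    apply WeightedL2.ext; intro n
    have h0 := z.2 (n - 1)
    simp only [WeightedL2.mk_apply, sub_add_cancel]
    rw [inv_mul_cancel_left₀ h0]
  right_inv ξ := by
    apply WeightedL2.ext; intro n
    have h0 := z.2 n
    simp only [WeightedL2.mk_apply, add_sub_cancel_right]
    rw [mul_inv_cancel_left₀ h0]

/-- The unitary `(U_z ξ)_n = m₀(θ₀(r_∞^n z)) ξ_{n+1}`. -/
def compU (z : S.regularSet) : S.compSpace z ≃ₗᵢ[ℂ] S.compSpace z where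
  toLinearEquiv := S.compULin z
  norm_map' ξ := by
    have h : ‖S.compULin z ξ‖ ^ 2 = ‖ξ‖ ^ 2 := by
      rw [WeightedL2.norm_sq_eq, WeightedL2.norm_sq_eq,
        ← (Equiv.addRight (1 : ℤ)).tsum_eq (fun n => ‖ξ n‖ ^ 2 * ‖(S.mTildeUnit z n : ℂ)‖ ^ 2)]
      refine tsum_congr fun n => ?_
      change ‖S.m0 (S.orbit z n) * ξ (n + 1)‖ ^ 2 * _ =
        ‖ξ (n + 1)‖ ^ 2 * ‖(S.mTildeUnit z (n + 1) : ℂ)‖ ^ 2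
      rw [norm_mTildeUnit_succ, norm_mul]
      ring
    exact (sq_eq_sq₀ (norm_nonneg _) (norm_nonneg _)).1 h

@[simp] theorem compU_apply (z : S.regularSet) (ξ : S.compSpace z) (n : ℤ) :
    S.compU z ξ n = S.m0 (S.orbit z n) * ξ (n + 1) := rfl

theorem compU_symm_apply (z : S.regularSet) (ξ : S.compSpace z) (n : ℤ) :
    (S.compU z).symm ξ n = (S.m0 (S.orbit z (n - 1)))⁻¹ * ξ (n - 1) := rfl

theorem compπ_bound (z : S.regularSet) (f : BoundedBorel X) :
    ∃ C : ℝ, 0 ≤ C ∧ ∀ (ξ : S.compSpace z) (n : ℤ),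
      ‖(f : X → ℂ) (S.orbit z n) * ξ n‖ ^ 2 * ‖(S.mTildeUnit z n : ℂ)‖ ^ 2
        ≤ C ^ 2 * (‖ξ n‖ ^ 2 * ‖(S.mTildeUnit z n : ℂ)‖ ^ 2) := by
  obtain ⟨C, hC⟩ := f.2.2
  refine ⟨C, (norm_nonneg _).trans (hC (S.orbit z 0)), fun ξ n => ?_⟩
  rw [norm_mul, mul_pow, mul_assoc]
  have := hC (S.orbit z n)
  gcongr

/-- `(π_z(f) ξ)_n = f(θ₀(r_∞^n z)) ξ_n`, as a linear map. -/
def compπLin (z : S.regularSet) (f : BoundedBorel X) : S.compSpace z →ₗ[ℂ] S.compSpace z where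
  toFun ξ := WeightedL2.mk (fun n => (f : X → ℂ) (S.orbit z n) * ξ n) (by
    obtain ⟨C, -, hC⟩ := S.compπ_bound z f
    exact Summable.of_nonneg_of_le (fun n => by positivity) (hC ξ) (ξ.summable.mul_left _))
  map_add' ξ η := by apply WeightedL2.ext; intro n; simp [mul_add]
  map_smul' c ξ := by apply WeightedL2.ext; intro n; simp; ring

theorem compπLin_bound (z : S.regularSet) (f : BoundedBorel X) :
    ∃ C : ℝ, ∀ ξ, ‖S.compπLin z f ξ‖ ≤ C * ‖ξ‖ := by
  obtain ⟨C, hC0, hC⟩ := S.compπ_bound z f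
  refine ⟨C, fun ξ => ?_⟩
  rw [← sq_le_sq₀ (norm_nonneg _) (by positivity), mul_pow, WeightedL2.norm_sq_eq,
    WeightedL2.norm_sq_eq, ← tsum_mul_left]
  exact Summable.tsum_le_tsum (hC ξ) (S.compπLin z f ξ).summable (ξ.summable.mul_left _)

/-- `(π_z(f) ξ)_n = f(θ₀(r_∞^n z)) ξ_n`, as a bounded operator. -/
def compπOp (z : S.regularSet) (f : BoundedBorel X) : S.compSpace z →L[ℂ] S.compSpace z :=
  LinearMap.mkContinuousOfExistsBound (S.compπLin z f) (S.compπLin_bound z f)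

@[simp] theorem compπOp_apply (z : S.regularSet) (f : BoundedBorel X) (ξ : S.compSpace z)
    (n : ℤ) : S.compπOp z f ξ n = (f : X → ℂ) (S.orbit z n) * ξ n := rfl

/-- The component representation `[H_z, U_z, π_z]`. -/
def compRep (z : S.regularSet) : CovariantRep S.r S.measurable_r (S.compSpace z) where
  U := S.compU z
  π :=
    { toFun := S.compπOp z
      map_one' := by ext ξ; apply WeightedL2.ext; intro n; simp
      map_mul' := by intro f g; ext ξ; apply WeightedL2.ext; intro n; simp [mul_assoc]
      map_zero' := by ext ξ; apply WeightedL2.ext; intro n; simp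
      map_add' := by intro f g; ext ξ; apply WeightedL2.ext; intro n; simp [add_mul]
      commutes' := by
        intro c; ext ξ; apply WeightedL2.ext; intro n
        simp [Algebra.algebraMap_eq_smul_one]
      map_star' := by
        intro f
        rw [ContinuousLinearMap.star_eq_adjoint, ContinuousLinearMap.eq_adjoint_iff]
        intro ξ η
        rw [WeightedL2.inner_def, WeightedL2.inner_def]
        refine tsum_congr fun n => ?_
        simp
        ring }
  covariance f ξ := by
    apply WeightedL2.ext; intro n
    have h0 := z.2 n
    change S.m0 (S.orbit z n) * ((f : X → ℂ) (S.orbit z (n + 1)) *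
      ((S.m0 (S.orbit z (n + 1 - 1)))⁻¹ * ξ (n + 1 - 1))) = (f : X → ℂ) (S.r (S.orbit z n)) * ξ n
    rw [add_sub_cancel_right, orbit_succ]
    field_simp

/-- The measurable field `z ↦ H_z`: a section is measurable iff its coordinates are. -/
def compField : MeasurableField S.compSpace where
  sections :=
    { carrier := {ξ | ∀ n : ℤ, Measurable fun z => ξ z n}
      zero_mem' := fun _ => measurable_const
      add_mem' := fun hξ hη n => (hξ n).add (hη n)
      smul_mem' := fun c _ hξ n => (hξ n).const_mul c }
  measurable_norm ξ hξ := by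
    have e (z) : ‖ξ z‖ = Real.sqrt (∑' n, ENNReal.ofReal
        (‖ξ z n‖ ^ 2 * ‖(S.mTildeUnit z n : ℂ)‖ ^ 2)).toReal := by
      rw [← Real.sqrt_sq (norm_nonneg (ξ z)), WeightedL2.norm_sq_eq,
        ← ENNReal.ofReal_tsum_of_nonneg (fun n => by positivity) (ξ z).summable,
        ENNReal.toReal_ofReal (tsum_nonneg fun n => by positivity)]
    simp only [e]
    refine (Measurable.tsum fun n => ?_).ennreal_toReal.sqrt
    have h1 : Measurable fun z : S.regularSet => S.mTilde z n :=
      (S.measurable_mTilde n).comp measurable_subtype_coe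
    have h2 := hξ n
    simp only [mTildeUnit, Units.val_mk0]
    fun_prop
  mem_of_measurable_inner η hη n := by
    have h := hη (fun z => WeightedL2.delta n) (fun m => measurable_const)
    have h1 : Measurable fun z : S.regularSet => S.mTilde z n :=
      (S.measurable_mTilde n).comp measurable_subtype_coe
    have e (z) : η z n = inner ℂ (WeightedL2.delta n) (η z) / (‖S.mTilde z n‖ ^ 2 : ℝ) := by
      have h0 : S.mTilde z n ≠ 0 := (S.mTildeUnit z n).ne_zero
      rw [WeightedL2.inner_delta]
      simp [mTildeUnit, h0]
    simp only [e]
    fun_prop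
  exists_total := by
    obtain ⟨f, hf⟩ := exists_surjective_nat ℤ
    refine ⟨fun n z => WeightedL2.delta (f n), fun n m => measurable_const, fun z => ?_⟩
    rw [← WeightedL2.span_delta_dense]
    congr 2
    exact hf.range_comp (WeightedL2.delta (w := S.mTildeUnit z))

/-- A measurable set whose translates under `r_∞` cover the solenoid and are pairwise disjoint,
up to `μ_∞`-null sets. -/
def IsFundamentalDomain (F : Set S.Solenoid) : Prop :=
  MeasurableSet F ∧
  S.μInf (⋃ n : ℤ, (S.rInf ^ n : Equiv.Perm S.Solenoid) '' F)ᶜ = 0 ∧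
  ∀ n m : ℤ, n ≠ m → S.μInf ((S.rInf ^ n : Equiv.Perm S.Solenoid) '' F ∩
    (S.rInf ^ m : Equiv.Perm S.Solenoid) '' F) = 0

/-- The restriction of `μ_∞` to `F`, on the set of points at which `H_z` is defined. -/
def domainMeasure (F : Set S.Solenoid) : Measure S.regularSet :=
  (S.μInf.restrict F).comap Subtype.val

/-- `R` is the wavelet representation on `L²(X_∞, μ_∞)`:
`U ξ = (m₀ ∘ θ₀) · (ξ ∘ r_∞)` and `π(f) ξ = (f ∘ θ₀) · ξ`, where `π(f)` depends only on the class
of `f` in `L^∞(X, μ)`. -/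
def IsWaveletRep (R : CovariantRep S.r S.measurable_r (Lp ℂ 2 S.μInf)) : Prop :=
  (∀ ξ : Lp ℂ 2 S.μInf, R.U ξ =ᵐ[S.μInf] fun z => S.m0 (S.θ₀ z) * ξ (S.rInf z)) ∧
  (∀ (f : BoundedBorel X) (ξ : Lp ℂ 2 S.μInf),
    R.π f ξ =ᵐ[S.μInf] fun z => (f : X → ℂ) (S.θ₀ z) * ξ z) ∧
  ∀ f g : BoundedBorel X, (f : X → ℂ) =ᵐ[S.μ] (g : X → ℂ) → R.π f = R.π g

/-- `[H, U, π] = ∫_F^⊕ [H_z, U_z, π_z] dμ_∞(z)`: some unitary from `H` onto the direct integral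
of the spaces `H_z` carries `U` to `∫^⊕ U_z` and each `π(f)` to `∫^⊕ π_z(f)`. -/
def IsDirectIntegralOver (F : Set S.Solenoid) {H : Type*} [NormedAddCommGroup H]
    [InnerProductSpace ℂ H] [CompleteSpace H] (R : CovariantRep S.r S.measurable_r H) : Prop :=
  ∃ Ψ : H ≃ₗᵢ[ℂ] S.compField.DirectIntegral (S.domainMeasure F),
    S.compField.IsFibrewise (S.domainMeasure F) (fun v => Ψ (R.U (Ψ.symm v)))
      (fun z => (S.compRep z).U) ∧
    ∀ f : BoundedBorel X,
      S.compField.IsFibrewise (S.domainMeasure F) (fun v => Ψ (R.π f (Ψ.symm v)))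
        (fun z => (S.compRep z).π f)

end FilterSystem

end

/-!
Strong invariance of `μ` gives
`∫ |m₀ ∘ θ₀|² (G ∘ r_∞) dμ_∞ = ∫ G dμ_∞` (`FilterSystem.lintegral_rInf`), so that `r_∞` is
nonsingular, `|m̃_n|²` is the density of `μ_∞ ∘ r_∞^n`, and `U` is unitary. The theorem says that
this nonsingular transformation is dissipative and free: over a fundamental domain `F`, a function
on the solenoid is a function on `F × ℤ`, and `L²(X_∞, μ_∞)` becomes the direct integral of the
weighted sequence spaces `H_z`, on which `U` and `π(f)` act along the orbit of `z`.

*Dissipativity.* By Jensen's inequality `∫ log |m₀|² dμ < 0`. If `∑_{n ≥ 0} |m̃_n|²` were infinite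
on a set of positive measure then, by ergodicity, it would be infinite a.e., the Birkhoff sums of
`log |m₀|² + ε` would be positive infinitely often a.e., and the maximal ergodic inequality would
give `∫ (log |m₀|² + ε) dμ ≥ 0` for small `ε > 0`. Hence the sum is finite a.e.
(`FilterSystem.ae_forwardSum_ne_top`). On the set `E` where it is at most `k`, the measures
`μ_∞ (r_∞^n E) = ∫_E |m̃_n|² dμ_∞` add up to at most `k`, so that by the Borel–Cantelli lemma a.e.
point enters `E` only finitely often in backward time (`FilterSystem.ae_finite_forwardSum_le`). So
along a.e. orbit the rounded sum attains its minimum for a first time, and the points at which this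
happens form a fundamental domain (`FilterSystem.domain`).

*Freeness and irreducibility.* Periodic points of `r` form a `μ`-null set
(`FilterSystem.measure_periodic_eq_zero`), so the points `θ₀ (r_∞^n z)`, `n ∈ ℤ`, are distinct for
a.e. `z`. Then the operators `π_z(f)` include the coordinate projections of `H_z`, whose
ranges `U_z` shifts, and irreducibility follows (`FilterSystem.compRep_irreducible`).

*Measurability.* That `x ↦ P_x` is measurable follows from strong invariance itself: the averages
`x ↦ (#r⁻¹(x))⁻¹ ∑_{r(y) = x} f(y)` are `μ`-a.e. measurable, since the Bochner integral of a
non-measurable function is `0` (`FilterSystem.aestronglyMeasurable_average`). No measurable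
selection of the preimages under `r` is needed.
-/

noncomputable section

namespace FilterSystem

/-! ### The averaging operator and the transfer operator -/

section Transfer

variable {X : Type*} [MeasurableSpace X] (S : FilterSystem X)

instance : IsProbabilityMeasure S.μ := S.isProbabilityMeasure

/-- The average of `f` over the fibres of `r`, for functions with values in `[0, ∞]`. -/
def avg (f : X → ℝ≥0∞) (x : X) : ℝ≥0∞ :=
  ((S.r ⁻¹' {x}).ncard : ℝ≥0∞)⁻¹ * ∑ y ∈ S.fiber x, f y

/-- The transfer operator `f ↦ ∑_{r(y) = x} W(y) f(y)`, for functions with values in `[0, ∞]`. -/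
def transfer (f : X → ℝ≥0∞) (x : X) : ℝ≥0∞ :=
  ∑ y ∈ S.fiber x, ENNReal.ofReal (S.W y) * f y

theorem card_fiber_pos (x : X) : 0 < (S.r ⁻¹' {x}).ncard := by
  rw [Set.ncard_pos (S.finite_fiber x)]
  exact S.surjective_r x

theorem card_fiber (x : X) : (S.fiber x).card = (S.r ⁻¹' {x}).ncard :=
  (Set.ncard_eq_toFinset_card _ (S.finite_fiber x)).symm

theorem avg_mono {f g : X → ℝ≥0∞} (h : f ≤ g) : S.avg f ≤ S.avg g := fun x => by
  unfold avg
  gcongr with y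
  exact h y

/-- The right-hand side of strong invariance is measurable. Otherwise its Bochner integral would
be `0` for each function with nonzero integral, such as `f` or `f + 1`. -/
theorem aestronglyMeasurable_average (f : X → ℂ) (hf : Measurable f)
    (hb : ∃ C : ℝ, ∀ x, ‖f x‖ ≤ C) :
    AEStronglyMeasurable (fun x => (1 / ((S.r ⁻¹' {x}).ncard : ℂ)) * ∑ y ∈ S.fiber x, f y) S.μ := by
  have key : ∀ g : X → ℂ, Measurable g → (∃ C : ℝ, ∀ x, ‖g x‖ ≤ C) → ∫ x, g x ∂S.μ ≠ 0 →
      AEStronglyMeasurable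
        (fun x => (1 / ((S.r ⁻¹' {x}).ncard : ℂ)) * ∑ y ∈ S.fiber x, g y) S.μ := by
    intro g hg hgb h0
    rw [S.strongly_invariant g hg hgb] at h0
    by_contra hn
    exact h0 (integral_non_aestronglyMeasurable hn)
  by_cases h0 : ∫ x, f x ∂S.μ = 0
  · obtain ⟨C, hC⟩ := hb
    have hint : Integrable f S.μ :=
      (integrable_const C).mono' hf.aestronglyMeasurable (Filter.Eventually.of_forall hC)
    have h1 := key (fun x => f x + 1) (hf.add_const 1)
      ⟨C + 1, fun x => (norm_add_le _ _).trans (by simpa using hC x)⟩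
      (by rw [integral_add hint (integrable_const _), h0]; simp)
    refine (h1.sub (aestronglyMeasurable_const (b := (1 : ℂ)))).congr
      (Filter.Eventually.of_forall fun x => ?_)
    have h2 : ((S.r ⁻¹' {x}).ncard : ℂ) ≠ 0 := by exact_mod_cast (S.card_fiber_pos x).ne'
    simp only [Pi.sub_apply, Finset.sum_add_distrib, Finset.sum_const, S.card_fiber]
    simp only [nsmul_eq_mul]
    field_simp
    ring
  · exact key f hf hb h0

theorem avg_of_bounded (f : X → ℝ) (hf : Measurable f) (h0 : ∀ x, 0 ≤ f x) (C : ℝ)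
    (hC : ∀ x, f x ≤ C) :
    AEMeasurable (S.avg fun x => ENNReal.ofReal (f x)) S.μ ∧
      ∫⁻ x, S.avg (fun x => ENNReal.ofReal (f x)) x ∂S.μ = ∫⁻ x, ENNReal.ofReal (f x) ∂S.μ := by
  have hfm : Measurable fun x => (f x : ℂ) := Complex.measurable_ofReal.comp hf
  have hfb : ∃ C : ℝ, ∀ x, ‖(f x : ℂ)‖ ≤ C := ⟨C, fun x => by
    rw [Complex.norm_real, Real.norm_of_nonneg (h0 x)]; exact hC x⟩
  have hm := S.aestronglyMeasurable_average _ hfm hfb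
  have hi := S.strongly_invariant _ hfm hfb
  set A : X → ℝ := fun x => ((S.r ⁻¹' {x}).ncard : ℝ)⁻¹ * ∑ y ∈ S.fiber x, f y with hA
  have hA0 : ∀ x, 0 ≤ A x := fun x =>
    mul_nonneg (by positivity) (Finset.sum_nonneg fun y _ => h0 y)
  have e : ∀ x, (1 / ((S.r ⁻¹' {x}).ncard : ℂ)) * ∑ y ∈ S.fiber x, (f y : ℂ) = (A x : ℂ) := by
    intro x; simp [hA]
  have hAC : ∀ x, A x ≤ C := by
    intro x
    have h1 : ∑ y ∈ S.fiber x, f y ≤ ((S.r ⁻¹' {x}).ncard : ℝ) * C := by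
      rw [← S.card_fiber, ← nsmul_eq_mul]
      exact Finset.sum_le_card_nsmul _ _ _ fun y _ => hC y
    have h2 : (0 : ℝ) < (S.r ⁻¹' {x}).ncard := by exact_mod_cast S.card_fiber_pos x
    rw [hA]
    simp only
    rw [inv_mul_le_iff₀ h2]
    exact h1
  have e' : (S.avg fun x => ENNReal.ofReal (f x)) = fun x => ENNReal.ofReal (A x) := by
    funext x
    have h2 : (0 : ℝ) < (S.r ⁻¹' {x}).ncard := by exact_mod_cast S.card_fiber_pos x
    rw [hA]
    simp only [avg]
    rw [ENNReal.ofReal_mul (by positivity), ENNReal.ofReal_inv_of_pos h2, ENNReal.ofReal_natCast,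
      ENNReal.ofReal_sum_of_nonneg fun y _ => h0 y]
  have hAm : AEStronglyMeasurable A S.μ := by
    simp only [e] at hm
    simpa using Complex.continuous_re.comp_aestronglyMeasurable hm
  have hAi : Integrable A S.μ := (integrable_const C).mono' hAm
    (Filter.Eventually.of_forall fun x => by rw [Real.norm_of_nonneg (hA0 x)]; exact hAC x)
  have hfi : Integrable f S.μ := (integrable_const C).mono' hf.aestronglyMeasurable
    (Filter.Eventually.of_forall fun x => by rw [Real.norm_of_nonneg (h0 x)]; exact hC x)
  rw [e']
  refine ⟨hAm.aemeasurable.ennreal_ofReal, ?_⟩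
  rw [← ofReal_integral_eq_lintegral_ofReal hAi (Filter.Eventually.of_forall hA0),
    ← ofReal_integral_eq_lintegral_ofReal hfi (Filter.Eventually.of_forall h0)]
  congr 1
  change ∫ x, (f x : ℂ) ∂S.μ =
    ∫ x, (1 / ((S.r ⁻¹' {x}).ncard : ℂ)) * ∑ y ∈ S.fiber x, (f y : ℂ) ∂S.μ at hi
  simp only [e] at hi
  rw [integral_complex_ofReal, integral_complex_ofReal] at hi
  exact_mod_cast hi.symm

theorem avg_of_measurable (f : X → ℝ≥0∞) (hf : Measurable f) :
    AEMeasurable (S.avg f) S.μ ∧ ∫⁻ x, S.avg f x ∂S.μ = ∫⁻ x, f x ∂S.μ := by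
  have htrunc : ∀ n : ℕ, AEMeasurable (S.avg fun x => min (f x) n) S.μ ∧
      ∫⁻ x, S.avg (fun x => min (f x) n) x ∂S.μ = ∫⁻ x, min (f x) n ∂S.μ := by
    intro n
    have h := S.avg_of_bounded (fun x => (min (f x) n).toReal)
      (hf.min measurable_const).ennreal_toReal (fun x => ENNReal.toReal_nonneg) n (fun x => by
        rw [← ENNReal.toReal_natCast n]
        exact ENNReal.toReal_mono (ENNReal.natCast_ne_top n) (min_le_right _ _))
    have e : ∀ x, ENNReal.ofReal (min (f x) n).toReal = min (f x) n := fun x =>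
      ENNReal.ofReal_toReal (ne_top_of_le_ne_top (ENNReal.natCast_ne_top n) (min_le_right _ _))
    simpa only [e] using h
  have hmono : ∀ x, Monotone fun n : ℕ => min (f x) (n : ℝ≥0∞) := fun x n m h =>
    min_le_min le_rfl (by exact_mod_cast h)
  have hsup : ∀ x, ⨆ n : ℕ, min (f x) (n : ℝ≥0∞) = f x := fun x => by
    rw [← inf_iSup_eq, ENNReal.iSup_natCast, inf_top_eq]
  have hmono' : ∀ x, Monotone fun n : ℕ => S.avg (fun x => min (f x) (n : ℝ≥0∞)) x :=
    fun x n m h => S.avg_mono (fun y => hmono y h) x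
  have hsup' : ∀ x, ⨆ n : ℕ, S.avg (fun x => min (f x) (n : ℝ≥0∞)) x = S.avg f x := fun x => by
    simp only [avg]
    rw [← ENNReal.mul_iSup, ← ENNReal.finsetSum_iSup_of_monotone fun y => hmono y]
    simp only [hsup]
  constructor
  · have : S.avg f = fun x => ⨆ n : ℕ, S.avg (fun x => min (f x) (n : ℝ≥0∞)) x :=
      funext fun x => (hsup' x).symm
    rw [this]
    exact AEMeasurable.iSup fun n => (htrunc n).1
  · simp only [← hsup']
    rw [lintegral_iSup' (fun n => (htrunc n).1) (Filter.Eventually.of_forall hmono')]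
    simp only [(htrunc _).2]
    rw [← lintegral_iSup (fun n => hf.min measurable_const) (fun n m h x => hmono x h)]
    simp only [hsup]

/-- Almost every fibre avoids a given null set. -/
theorem ae_forall_fiber {p : X → Prop} (hp : ∀ᵐ x ∂S.μ, p x) :
    ∀ᵐ x ∂S.μ, ∀ y ∈ S.fiber x, p y := by
  obtain ⟨N, hN, hNm, hN0⟩ := exists_measurable_superset_of_null (ae_iff.1 hp)
  obtain ⟨h1, h2⟩ := S.avg_of_measurable (N.indicator fun _ => 1) (measurable_one.indicator hNm)
  rw [lintegral_indicator_const hNm, hN0, mul_zero, lintegral_eq_zero_iff' h1] at h2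
  filter_upwards [h2] with x hx y hy
  by_contra hpy
  simp only [avg, Pi.zero_apply, mul_eq_zero, ENNReal.inv_eq_zero, ENNReal.natCast_ne_top,
    false_or, Finset.sum_eq_zero_iff] at hx
  simpa [hN hpy] using hx y hy

theorem avg_of_aemeasurable (f : X → ℝ≥0∞) (hf : AEMeasurable f S.μ) :
    AEMeasurable (S.avg f) S.μ ∧ ∫⁻ x, S.avg f x ∂S.μ = ∫⁻ x, f x ∂S.μ := by
  obtain ⟨h1, h2⟩ := S.avg_of_measurable _ hf.measurable_mk
  have h : S.avg f =ᵐ[S.μ] S.avg (hf.mk f) := by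
    filter_upwards [S.ae_forall_fiber hf.ae_eq_mk] with x hx
    simp only [avg]
    rw [Finset.sum_congr rfl hx]
  exact ⟨h1.congr h.symm, by rw [lintegral_congr_ae h, h2, lintegral_congr_ae hf.ae_eq_mk]⟩

theorem transfer_eq_avg (f : X → ℝ≥0∞) :
    S.transfer f = S.avg fun y => ‖S.m0 y‖ₑ ^ 2 * f y := by
  funext x
  simp only [transfer, avg, Finset.mul_sum]
  refine Finset.sum_congr rfl fun y hy => ?_
  have h2 : (0 : ℝ) < (S.r ⁻¹' {x}).ncard := by exact_mod_cast S.card_fiber_pos x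
  rw [W, S.mem_fiber.1 hy, ENNReal.ofReal_div_of_pos h2, ENNReal.ofReal_natCast,
    ENNReal.ofReal_pow (norm_nonneg _), ofReal_norm, div_eq_mul_inv]
  ring

theorem transfer_one : S.transfer (fun _ => 1) = fun _ => 1 := by
  funext x
  simp only [transfer, mul_one]
  rw [← ENNReal.ofReal_sum_of_nonneg fun y _ => S.W_nonneg y, S.sum_W, ENNReal.ofReal_one]

theorem aemeasurable_transfer {f : X → ℝ≥0∞} (hf : AEMeasurable f S.μ) :
    AEMeasurable (S.transfer f) S.μ := by
  rw [transfer_eq_avg]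
  exact (S.avg_of_aemeasurable _ ((S.measurable_m0.enorm.pow_const 2).aemeasurable.mul hf)).1

theorem lintegral_transfer {f : X → ℝ≥0∞} (hf : AEMeasurable f S.μ) :
    ∫⁻ x, S.transfer f x ∂S.μ = ∫⁻ x, ‖S.m0 x‖ₑ ^ 2 * f x ∂S.μ := by
  rw [transfer_eq_avg]
  exact (S.avg_of_aemeasurable _ ((S.measurable_m0.enorm.pow_const 2).aemeasurable.mul hf)).2

theorem lintegral_enorm_m0_sq : ∫⁻ x, ‖S.m0 x‖ₑ ^ 2 ∂S.μ = 1 := by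
  have h := S.lintegral_transfer (f := fun _ => 1) aemeasurable_const
  simpa [S.transfer_one] using h.symm

end Transfer

/-! ### The path measures -/

section Path

variable {X : Type*} [MeasurableSpace X] (S : FilterSystem X)

/-- The law of the random walk started at `x` on all sequences in the discrete copy of `X`. -/
def walk (x : X) : Measure (ℕ → DiscreteCopy X) :=
  Kernel.traj (X := fun _ => DiscreteCopy X) S.stepKernel 0 (fun _ => DiscreteCopy.mk x)

instance (x : X) : IsProbabilityMeasure (S.walk x) := by
  unfold walk; infer_instance

/-- Forgets the discrete `σ`-algebra. -/
def undiscrete (p : ℕ → DiscreteCopy X) (n : ℕ) : X := (p n).val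

omit [MeasurableSpace X] in
theorem measurable_val_comp {β : Type*} [MeasurableSpace β] (f : X → β) :
    Measurable fun p : DiscreteCopy X => f p.val := measurable_from_top

theorem measurable_undiscrete : Measurable (undiscrete (X := X)) :=
  measurable_pi_lambda _ fun n => (measurable_val_comp id).comp (measurable_pi_apply n)

theorem lintegral_step (x : X) (g : DiscreteCopy X → ℝ≥0∞) :
    ∫⁻ y, g y ∂(S.step x) = S.transfer (fun y => g ⟨y⟩) x := by
  simp only [step, transfer, lintegral_finsetSum_measure, lintegral_smul_measure, smul_eq_mul]
  refine Finset.sum_congr rfl fun y _ => ?_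
  rw [lintegral_dirac' _ measurable_from_top]

/-- The Markov property at time `n`. -/
theorem lintegral_walk_succ (x : X) (n : ℕ)
    (H : ((i : Finset.Iic n) → DiscreteCopy X) × DiscreteCopy X → ℝ≥0∞) (hH : Measurable H) :
    ∫⁻ p, H (Preorder.frestrictLe n p, p (n + 1)) ∂(S.walk x) =
      ∫⁻ p, S.transfer (fun y => H (Preorder.frestrictLe n p, ⟨y⟩)) (p n).val ∂(S.walk x) := by
  have h := Kernel.partialTraj_compProd_eq_map_traj (X := fun _ => DiscreteCopy X)
    (κ := S.stepKernel) (Nat.zero_le n) (x₀ := fun _ => DiscreteCopy.mk x)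
  have hm : Measurable fun p : ℕ → DiscreteCopy X =>
      ((Preorder.frestrictLe n p, p (n + 1)) :
        ((i : Finset.Iic n) → DiscreteCopy X) × DiscreteCopy X) := by fun_prop
  have h1 : ∫⁻ q, H q ∂((S.walk x).map fun p => (Preorder.frestrictLe n p, p (n + 1))) =
      ∫⁻ p, H (Preorder.frestrictLe n p, p (n + 1)) ∂(S.walk x) := lintegral_map hH hm
  rw [← h1, walk, ← h, Measure.lintegral_compProd hH,
    ← Kernel.traj_map_frestrictLe_apply, lintegral_map (by fun_prop) (by fun_prop)]
  refine lintegral_congr fun p => ?_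
  exact S.lintegral_step _ _

theorem walk_zero (x : X) : ∀ᵐ p ∂(S.walk x), (p 0).val = x := by
  have h := Kernel.traj_map_frestrictLe_apply (X := fun _ => DiscreteCopy X)
    (κ := S.stepKernel) 0 0 (fun _ => DiscreteCopy.mk x)
  rw [Kernel.partialTraj_self, Kernel.id_apply] at h
  have hm : MeasurableSet {q : (i : Finset.Iic 0) → DiscreteCopy X |
      (q ⟨0, Finset.mem_Iic.2 le_rfl⟩).val = x} := by
    have : Measurable fun q : (i : Finset.Iic 0) → DiscreteCopy X =>
      q ⟨0, Finset.mem_Iic.2 le_rfl⟩ := measurable_pi_apply _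
    exact this (t := {d | d.val = x}) trivial
  have h2 : ∀ᵐ q ∂((S.walk x).map (Preorder.frestrictLe 0)),
      (q ⟨0, Finset.mem_Iic.2 le_rfl⟩).val = x := by
    rw [walk, h, ae_dirac_iff hm]
  exact ae_of_ae_map (by fun_prop) h2

/-- The iterated transfer operators that compute the expectation of
`f₀(x₀) ⋯ f_{n-1}(x_{n-1}) g(x_n)`. -/
def nest (f : ℕ → X → ℝ≥0∞) : ℕ → (X → ℝ≥0∞) → X → ℝ≥0∞
  | 0, g => g
  | n + 1, g => nest f n (f n * S.transfer g)

theorem nest_succ' (f : ℕ → X → ℝ≥0∞) (n : ℕ) (g : X → ℝ≥0∞) :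
    S.nest f (n + 1) g = f 0 * S.transfer (S.nest (fun i => f (i + 1)) n g) := by
  induction n generalizing g with
  | zero => rfl
  | succ n ih => exact ih _

theorem aemeasurable_nest {f : ℕ → X → ℝ≥0∞} (hf : ∀ i, AEMeasurable (f i) S.μ) (n : ℕ)
    {g : X → ℝ≥0∞} (hg : AEMeasurable g S.μ) : AEMeasurable (S.nest f n g) S.μ := by
  induction n generalizing g with
  | zero => exact hg
  | succ n ih => exact ih ((hf n).mul (S.aemeasurable_transfer hg))

theorem lintegral_walk_prod (x : X) (f : ℕ → X → ℝ≥0∞) (n : ℕ) (g : X → ℝ≥0∞) :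
    ∫⁻ p, (∏ i ∈ Finset.range n, f i (p i).val) * g (p n).val ∂(S.walk x) = S.nest f n g x := by
  induction n generalizing g with
  | zero =>
    simp only [Finset.range_zero, Finset.prod_empty, one_mul, nest]
    rw [lintegral_congr_ae (g := fun _ => g x) ((S.walk_zero x).mono fun p hp => by simp only [hp])]
    simp
  | succ n ih =>
    rw [nest, ← ih]
    have hH : Measurable fun q : ((i : Finset.Iic n) → DiscreteCopy X) × DiscreteCopy X =>
        (∏ i : Finset.Iic n, f i (q.1 i).val) * g q.2.val := by
      refine Measurable.mul ?_ ((measurable_val_comp g).comp measurable_snd)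
      exact Finset.measurable_fun_prod _ fun i _ =>
        (measurable_val_comp (f i)).comp ((measurable_pi_apply i).comp measurable_fst)
    have h := S.lintegral_walk_succ x n _ hH
    have e (p : ℕ → DiscreteCopy X) :
        ∏ i : Finset.Iic n, f i (Preorder.frestrictLe n p i).val =
          ∏ i ∈ Finset.range (n + 1), f i (p i).val := by
      have : Finset.range (n + 1) = Finset.Iic n := by ext; simp
      rw [this]
      exact Finset.prod_coe_sort (Finset.Iic n) fun i => f i (p i).val
    simp only [e] at h
    rw [h]
    refine lintegral_congr fun p => ?_
    simp only [transfer, Pi.mul_apply, Finset.prod_range_succ, Finset.mul_sum]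
    refine Finset.sum_congr rfl fun y _ => ?_
    ring

end Path

end FilterSystem

/-! ### Measurable families of probability measures -/

/-- A family of probability measures on a countably generated space is a.e. measurable once its
values on each measurable set are. -/
theorem aemeasurable_measure_of_forall_apply {α β : Type*} [MeasurableSpace α] [MeasurableSpace β]
    [MeasurableSpace.CountablyGenerated β] {μ : Measure α} (κ : α → Measure β)
    [∀ a, IsProbabilityMeasure (κ a)]
    (h : ∀ s, MeasurableSet s → AEMeasurable (fun a => κ a s) μ) : AEMeasurable κ μ := by
  classical
  rcases isEmpty_or_nonempty α with hα | ⟨⟨a₀⟩⟩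
  · exact ⟨κ, measurable_of_empty _, Filter.EventuallyEq.rfl⟩
  set C := generateSetAlgebra (MeasurableSpace.countableGeneratingSet β) with hC
  have hCc : C.Countable :=
    countable_generateSetAlgebra MeasurableSpace.countable_countableGeneratingSet
  have hgen : (inferInstance : MeasurableSpace β) = MeasurableSpace.generateFrom C := by
    rw [hC, generateFrom_generateSetAlgebra_eq,
      MeasurableSpace.generateFrom_countableGeneratingSet]
  have hpi : IsPiSystem C := fun s hs t ht _ => isSetAlgebra_generateSetAlgebra.inter_mem hs ht
  have hCm : ∀ s ∈ C, MeasurableSet s := fun s hs => by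
    have h1 := MeasurableSpace.measurableSet_generateFrom hs
    rwa [← hgen] at h1
  have hbad : ∀ᵐ a ∂μ, ∀ s (hs : s ∈ C), κ a s = (h s (hCm s hs)).mk _ a :=
    (ae_ball_iff hCc).2 fun s hs => (h s (hCm s hs)).ae_eq_mk
  obtain ⟨N, hN, hNm, hN0⟩ := exists_measurable_superset_of_null (ae_iff.1 hbad)
  have hN' : ∀ a, a ∉ N → ∀ s (hs : s ∈ C), κ a s = (h s (hCm s hs)).mk _ a := fun a ha => by
    by_contra hc
    exact ha (hN hc)
  set κ' : α → Measure β := fun a => if a ∈ N then κ a₀ else κ a with hκ'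
  have : ∀ a, IsProbabilityMeasure (κ' a) := fun a => by
    simp only [hκ']; split_ifs <;> infer_instance
  refine ⟨κ', Measurable.measure_of_isPiSystem_of_isProbabilityMeasure hgen hpi fun s hs => ?_, ?_⟩
  · have e : (fun a => κ' a s) = fun a => if a ∈ N then κ a₀ s else (h s (hCm s hs)).mk _ a := by
      funext a
      by_cases ha : a ∈ N
      · simp [hκ', ha]
      · simp only [hκ', ha, if_false]
        exact hN' a ha s hs
    rw [e]
    exact Measurable.ite hNm measurable_const (h s (hCm s hs)).measurable_mk
  · filter_upwards [compl_mem_ae_iff.2 hN0] with a ha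
    have : a ∉ N := ha
    simp [hκ', this]

namespace FilterSystem

/-! ### The measure `μ_∞` on the solenoid -/

section Solenoid

variable {X : Type*} [MeasurableSpace X] (S : FilterSystem X)

theorem walk_mem_solenoid [MeasurableEq X] (x : X) :
    ∀ᵐ p ∂(S.walk x), ∀ n, S.r (p (n + 1)).val = (p n).val := by
  rw [ae_all_iff]
  intro n
  have hA : MeasurableSet {q : ((i : Finset.Iic n) → DiscreteCopy X) × DiscreteCopy X |
      S.r q.2.val = (q.1 ⟨n, Finset.mem_Iic.2 le_rfl⟩).val} := by
    refine measurableSet_eq_fun ((measurable_val_comp S.r).comp measurable_snd) ?_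
    exact (measurable_val_comp id).comp ((measurable_pi_apply _).comp measurable_fst)
  have h := S.lintegral_walk_succ x n _ (measurable_one.indicator hA.compl)
  have h0 : ∀ p : ℕ → DiscreteCopy X, S.transfer (fun y =>
      Set.indicator {q : ((i : Finset.Iic n) → DiscreteCopy X) × DiscreteCopy X |
        S.r q.2.val = (q.1 ⟨n, Finset.mem_Iic.2 le_rfl⟩).val}ᶜ 1
        (Preorder.frestrictLe n p, ⟨y⟩)) (p n).val = 0 := by
    intro p
    refine Finset.sum_eq_zero fun y hy => ?_
    refine mul_eq_zero_of_right _ (Set.indicator_of_notMem ?_ _)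
    simpa using S.mem_fiber.1 hy
  simp only [h0, lintegral_zero] at h
  have hm : Measurable fun p : ℕ → DiscreteCopy X =>
      ((Preorder.frestrictLe n p, p (n + 1)) :
        ((i : Finset.Iic n) → DiscreteCopy X) × DiscreteCopy X) := by fun_prop
  replace h := (lintegral_eq_zero_iff ((measurable_one.indicator hA.compl).comp hm)).1 h
  filter_upwards [h] with p hp
  by_contra hc
  simp only [Function.comp, Pi.zero_apply, Set.indicator_apply_eq_zero, Pi.one_apply, one_ne_zero,
    imp_false, Set.mem_compl_iff, not_not, Set.mem_ofPred_eq] at hp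
  exact hc hp

theorem measurableSet_solenoid [MeasurableEq X] :
    MeasurableSet {x : ℕ → X | ∀ n, S.r (x (n + 1)) = x n} := by
  rw [Set.ofPred_forall]
  exact MeasurableSet.iInter fun n => measurableSet_eq_fun
    (S.measurable_r.comp (measurable_pi_apply _)) (measurable_pi_apply _)

/-- The sequence of coordinates of a point of the solenoid. -/
def coords (z : S.Solenoid) : ℕ → X := z.1

theorem range_coords : Set.range S.coords = {x : ℕ → X | ∀ n, S.r (x (n + 1)) = x n} :=
  Subtype.range_coe

theorem measurableEmbedding_coords [MeasurableEq X] : MeasurableEmbedding S.coords :=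
  MeasurableEmbedding.subtype_coe S.measurableSet_solenoid

theorem map_pathMeasure [MeasurableEq X] (x : X) :
    (S.pathMeasure x).map S.coords = (S.walk x).map undiscrete := by
  refine (S.measurableEmbedding_coords.map_comap ((S.walk x).map undiscrete)).trans ?_
  refine Measure.restrict_eq_self_of_ae_mem ?_
  rw [range_coords]
  exact (ae_map_iff measurable_undiscrete.aemeasurable S.measurableSet_solenoid).2
    (S.walk_mem_solenoid x)

instance [MeasurableEq X] (x : X) : IsProbabilityMeasure (S.pathMeasure x) := by
  have h : IsProbabilityMeasure ((S.walk x).map undiscrete) :=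
    Measure.isProbabilityMeasure_map measurable_undiscrete.aemeasurable
  rw [← S.map_pathMeasure x] at h
  exact Measure.isProbabilityMeasure_of_map S.coords

theorem measurable_coord (n : ℕ) : Measurable fun z : S.Solenoid => z.1 n :=
  (measurable_pi_apply n).comp measurable_subtype_coe

theorem measurable_θ₀ : Measurable S.θ₀ := S.measurable_coord 0

theorem lintegral_pathMeasure [MeasurableEq X] (x : X) {G : (ℕ → X) → ℝ≥0∞} (hG : Measurable G) :
    ∫⁻ z, G (S.coords z) ∂(S.pathMeasure x) = ∫⁻ p, G (undiscrete p) ∂(S.walk x) := by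
  rw [← lintegral_map hG measurable_undiscrete, ← S.map_pathMeasure x,
    lintegral_map hG S.measurableEmbedding_coords.measurable]

theorem ae_pathMeasure_θ₀ [MeasurableEq X] (x : X) : ∀ᵐ z ∂(S.pathMeasure x), S.θ₀ z = x := by
  have h : ∀ᵐ q ∂((S.walk x).map undiscrete), q 0 = x :=
    (ae_map_iff measurable_undiscrete.aemeasurable
      (measurable_pi_apply 0 (measurableSet_singleton x))).2 (S.walk_zero x)
  rw [← S.map_pathMeasure x] at h
  exact ae_of_ae_map S.measurableEmbedding_coords.measurable.aemeasurable h

theorem lintegral_pathMeasure_prod [MeasurableEq X] (x : X) {f : ℕ → X → ℝ≥0∞}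
    (hf : ∀ i, Measurable (f i)) (n : ℕ) {g : X → ℝ≥0∞} (hg : Measurable g) :
    ∫⁻ z, (∏ i ∈ Finset.range n, f i (z.1 i)) * g (z.1 n) ∂(S.pathMeasure x) = S.nest f n g x := by
  rw [← S.lintegral_walk_prod]
  exact S.lintegral_pathMeasure x (G := fun q => (∏ i ∈ Finset.range n, f i (q i)) * g (q n))
    (by fun_prop)

/-- The cylinder set of the points whose coordinates below `n` lie in prescribed sets. -/
def cyl (n : ℕ) (A : ℕ → Set X) : Set S.Solenoid := {z | ∀ i < n, z.1 i ∈ A i}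

/-- The cylinder sets with measurable bases. -/
def cylinders : Set (Set S.Solenoid) :=
  {s | ∃ n A, (∀ i, MeasurableSet (A i)) ∧ s = S.cyl n A}

theorem isPiSystem_cylinders : IsPiSystem S.cylinders := by
  classical
  rintro _ ⟨n, A, hA, rfl⟩ _ ⟨m, B, hB, rfl⟩ -
  refine ⟨max n m, fun i => (if i < n then A i else Set.univ) ∩ (if i < m then B i else Set.univ),
    fun i => ?_, ?_⟩
  · refine MeasurableSet.inter ?_ ?_ <;> split_ifs <;> simp [hA, hB]
  · ext z
    simp only [cyl, Set.mem_inter_iff, Set.mem_ofPred_eq, lt_max_iff]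
    constructor
    · rintro ⟨h1, h2⟩ i -
      constructor
      · split_ifs with h
        exacts [h1 i h, trivial]
      · split_ifs with h
        exacts [h2 i h, trivial]
    · intro h
      refine ⟨fun i hi => ?_, fun i hi => ?_⟩
      · simpa [hi] using (h i (Or.inl hi)).1
      · simpa [hi] using (h i (Or.inr hi)).2

theorem measurableSet_cyl (n : ℕ) {A : ℕ → Set X} (hA : ∀ i, MeasurableSet (A i)) :
    MeasurableSet (S.cyl n A) := by
  simp only [cyl, Set.ofPred_forall]
  exact MeasurableSet.iInter fun i => MeasurableSet.iInter fun _ => S.measurable_coord i (hA i)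

theorem generateFrom_cylinders :
    (inferInstance : MeasurableSpace S.Solenoid) = MeasurableSpace.generateFrom S.cylinders := by
  classical
  refine le_antisymm ?_ (MeasurableSpace.generateFrom_le ?_)
  · change MeasurableSpace.comap S.coords (⨆ i, MeasurableSpace.comap (fun q => q i) _) ≤ _
    rw [MeasurableSpace.comap_iSup]
    refine iSup_le fun i => ?_
    rw [MeasurableSpace.comap_comp]
    rintro _ ⟨A, hA, rfl⟩
    refine MeasurableSpace.measurableSet_generateFrom
      ⟨i + 1, fun j => if j = i then A else Set.univ, fun j => ?_, ?_⟩
    · dsimp only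
      split_ifs
      exacts [hA, MeasurableSet.univ]
    · ext z
      simp only [Set.mem_preimage, Function.comp, coords, cyl, Set.mem_ofPred_eq]
      constructor
      · intro h j _
        split_ifs with hj
        exacts [hj ▸ h, trivial]
      · intro h
        simpa using h i (Nat.lt_succ_self i)
  · rintro _ ⟨n, A, hA, rfl⟩
    exact S.measurableSet_cyl n hA

theorem indicator_cyl (n : ℕ) (A : ℕ → Set X) (z : S.Solenoid) :
    (S.cyl n A).indicator 1 z =
      ∏ i ∈ Finset.range n, (A i).indicator (1 : X → ℝ≥0∞) (z.1 i) := by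
  classical
  simp only [Set.indicator_apply, Pi.one_apply, Finset.prod_ite_zero, Finset.prod_const_one,
    Finset.mem_range, cyl, Set.mem_ofPred_eq]

theorem pathMeasure_cyl [MeasurableEq X] (x : X) (n : ℕ) {A : ℕ → Set X}
    (hA : ∀ i, MeasurableSet (A i)) :
    S.pathMeasure x (S.cyl n A) = S.nest (fun i => (A i).indicator 1) n (fun _ => 1) x := by
  rw [← S.lintegral_pathMeasure_prod x (fun i => measurable_one.indicator (hA i)) n
    measurable_const, ← lintegral_indicator_one (S.measurableSet_cyl n hA)]
  simp only [S.indicator_cyl, mul_one]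

instance [MeasurableSpace.CountablyGenerated X] :
    MeasurableSpace.CountablyGenerated S.Solenoid := by
  have : MeasurableSpace.CountablyGenerated (ℕ → X) := by
    have h (i : ℕ) := (MeasurableSpace.CountablyGenerated.comap
      (fun q : ℕ → X => q i)).isCountablyGenerated
    choose b hb hgen using h
    refine ⟨⋃ i, b i, Set.countable_iUnion hb, ?_⟩
    rw [← MeasurableSpace.iSup_generateFrom]
    exact iSup_congr hgen
  exact MeasurableSpace.CountablyGenerated.comap S.coords

variable [MeasurableEq X] [MeasurableSpace.CountablyGenerated X]

/-- The path measures depend a.e. measurably on the starting point, so that `μ_∞` is a genuine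
mixture. -/
theorem aemeasurable_pathMeasure : AEMeasurable S.pathMeasure S.μ := by
  refine aemeasurable_measure_of_forall_apply _ fun s hs => ?_
  induction s, hs using MeasurableSpace.induction_on_inter S.generateFrom_cylinders
    S.isPiSystem_cylinders with
  | empty => simp
  | basic s hs =>
    obtain ⟨n, A, hA, rfl⟩ := hs
    simp only [S.pathMeasure_cyl _ n hA]
    exact S.aemeasurable_nest (fun i => (measurable_one.indicator (hA i)).aemeasurable) n
      aemeasurable_const
  | compl s hsm ihs =>
    simp only [measure_compl hsm (measure_ne_top _ _), measure_univ]
    exact ihs.const_sub 1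
  | iUnion f hfd hfm ihf =>
    simp only [measure_iUnion hfd hfm]
    exact AEMeasurable.tsum ihf

theorem lintegral_μInf {G : S.Solenoid → ℝ≥0∞} (hG : Measurable G) :
    ∫⁻ z, G z ∂S.μInf = ∫⁻ x, ∫⁻ z, G z ∂(S.pathMeasure x) ∂S.μ :=
  Measure.lintegral_bind S.aemeasurable_pathMeasure hG.aemeasurable

instance : IsProbabilityMeasure S.μInf := by
  constructor
  rw [μInf, Measure.bind_apply MeasurableSet.univ S.aemeasurable_pathMeasure]
  simp

theorem lintegral_θ₀_mul {h : X → ℝ≥0∞} (hh : Measurable h) {G : S.Solenoid → ℝ≥0∞}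
    (hG : Measurable G) :
    ∫⁻ z, h (S.θ₀ z) * G z ∂S.μInf = ∫⁻ x, h x * ∫⁻ z, G z ∂(S.pathMeasure x) ∂S.μ := by
  refine (S.lintegral_μInf ((hh.comp S.measurable_θ₀).mul hG)).trans ?_
  refine lintegral_congr fun x => ?_
  rw [← lintegral_const_mul _ hG]
  exact lintegral_congr_ae ((S.ae_pathMeasure_θ₀ x).mono fun z hz =>
    congrArg (fun y => h y * G z) hz)

/-- The law of the starting point under `μ_∞` is `μ`. -/
theorem measurePreserving_θ₀ : MeasurePreserving S.θ₀ S.μInf S.μ := by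
  refine ⟨S.measurable_θ₀, Measure.ext fun A hA => ?_⟩
  have h := S.lintegral_θ₀_mul (measurable_one.indicator hA) (G := fun _ => 1) measurable_const
  simp only [lintegral_const, measure_univ, mul_one] at h
  rw [lintegral_indicator_one hA] at h
  rw [← h, ← lintegral_indicator_one hA,
    lintegral_map (measurable_one.indicator hA) S.measurable_θ₀]

/-- The Radon–Nikodym relation `d(μ_∞ ∘ r_∞) = |m₀ ∘ θ₀|² dμ_∞`. -/
theorem map_rInf_withDensity :
    (S.μInf.withDensity fun z => ‖S.m0 (S.θ₀ z)‖ₑ ^ 2).map S.rInf = S.μInf := by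
  have hD : Measurable fun z => ‖S.m0 (S.θ₀ z)‖ₑ ^ 2 :=
    (S.measurable_m0.enorm.pow_const 2).comp S.measurable_θ₀
  have key : ∀ n (A : ℕ → Set X), (∀ i, MeasurableSet (A i)) →
      (S.μInf.withDensity fun z => ‖S.m0 (S.θ₀ z)‖ₑ ^ 2) (S.rInf ⁻¹' (S.cyl (n + 1) A)) =
        S.μInf (S.cyl (n + 1) A) := by
    intro n A hA
    have hAm := fun i => measurable_one.indicator (β := ℝ≥0∞) (hA i)
    have hpre : S.rInf ⁻¹' (S.cyl (n + 1) A) =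
        {z | S.r (S.θ₀ z) ∈ A 0} ∩ S.cyl n (fun i => A (i + 1)) := by
      ext z
      simp only [cyl, Set.mem_preimage, Set.mem_ofPred_eq, Set.mem_inter_iff]
      constructor
      · intro h
        exact ⟨h 0 (Nat.succ_pos n), fun i hi => h (i + 1) (Nat.succ_lt_succ hi)⟩
      · rintro ⟨h0, h1⟩ i hi
        cases i with
        | zero => exact h0
        | succ i => exact h1 i (Nat.lt_of_succ_lt_succ hi)
    have hA0 : Measurable fun x => (A 0).indicator (1 : X → ℝ≥0∞) (S.r x) :=
      (hAm 0).comp S.measurable_r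
    have hcm := S.measurableSet_cyl n fun i => hA (i + 1)
    rw [withDensity_apply _ (S.measurable_rInf (S.measurableSet_cyl _ hA)),
      ← lintegral_indicator (S.measurable_rInf (S.measurableSet_cyl _ hA)), hpre]
    have e : ∀ z, ({z | S.r (S.θ₀ z) ∈ A 0} ∩ S.cyl n (fun i => A (i + 1))).indicator
        (fun z => ‖S.m0 (S.θ₀ z)‖ₑ ^ 2) z =
        (fun x => ‖S.m0 x‖ₑ ^ 2 * (A 0).indicator 1 (S.r x)) (S.θ₀ z) *
          (S.cyl n fun i => A (i + 1)).indicator 1 z := by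
      intro z
      by_cases h0 : S.r (S.θ₀ z) ∈ A 0 <;> by_cases h1 : z ∈ S.cyl n fun i => A (i + 1) <;>
        simp [h0, h1]
    rw [lintegral_congr e, S.lintegral_θ₀_mul
      (h := fun x => ‖S.m0 x‖ₑ ^ 2 * (A 0).indicator 1 (S.r x))
      ((S.measurable_m0.enorm.pow_const 2).mul hA0) (measurable_one.indicator hcm)]
    simp only [lintegral_indicator_one hcm]
    rw [μInf, Measure.bind_apply (S.measurableSet_cyl _ hA) S.aemeasurable_pathMeasure]
    simp only [S.pathMeasure_cyl _ _ hA,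
      S.pathMeasure_cyl _ n fun i => hA (i + 1), nest_succ']
    have hN : AEMeasurable (S.nest (fun i => (A (i + 1)).indicator 1) n fun _ => 1) S.μ :=
      S.aemeasurable_nest (fun i => (hAm (i + 1)).aemeasurable) n aemeasurable_const
    have e2 : ∀ x, ((A 0).indicator (1 : X → ℝ≥0∞) *
        S.transfer (S.nest (fun i => (A (i + 1)).indicator 1) n fun _ => 1)) x =
        S.transfer (fun y => (A 0).indicator 1 (S.r y) *
          S.nest (fun i => (A (i + 1)).indicator 1) n (fun _ => 1) y) x := by
      intro x
      simp only [transfer, Pi.mul_apply, Finset.mul_sum]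
      refine Finset.sum_congr rfl fun y hy => ?_
      rw [S.mem_fiber.1 hy]
      ring
    simp only [e2]
    refine Eq.trans ?_ (S.lintegral_transfer (hA0.aemeasurable.mul hN)).symm
    exact lintegral_congr fun x => mul_assoc _ _ _
  have huniv : S.cyl 1 (fun _ => Set.univ) = Set.univ := by ext z; simp [cyl]
  refine (ext_of_generate_finite _ S.generateFrom_cylinders S.isPiSystem_cylinders ?_ ?_).symm
  · rintro _ ⟨n, A, hA, rfl⟩
    rw [Measure.map_apply S.measurable_rInf (S.measurableSet_cyl _ hA)]
    cases n with
    | zero =>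
      have : S.cyl 0 A = S.cyl 1 (fun _ => Set.univ) := by rw [huniv]; ext z; simp [cyl]
      rw [this]
      exact (key 0 _ fun _ => MeasurableSet.univ).symm
    | succ n => exact (key n A hA).symm
  · rw [Measure.map_apply S.measurable_rInf MeasurableSet.univ, ← huniv]
    exact (key 0 _ fun _ => MeasurableSet.univ).symm

theorem lintegral_rInf {G : S.Solenoid → ℝ≥0∞} (hG : Measurable G) :
    ∫⁻ z, ‖S.m0 (S.θ₀ z)‖ₑ ^ 2 * G (S.rInf z) ∂S.μInf = ∫⁻ z, G z ∂S.μInf := by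
  have hD : Measurable fun z => ‖S.m0 (S.θ₀ z)‖ₑ ^ 2 :=
    (S.measurable_m0.enorm.pow_const 2).comp S.measurable_θ₀
  conv_rhs => rw [← S.map_rInf_withDensity]
  rw [lintegral_map hG S.measurable_rInf]
  exact (lintegral_withDensity_eq_lintegral_mul _ hD (hG.comp S.measurable_rInf)).symm

end Solenoid

end FilterSystem

/-! ### A maximal ergodic inequality -/

section Maximal

variable {X : Type*} [MeasurableSpace X] {μ : Measure X} {f : X → X} {φ : X → ℝ}

/-- The maximum of the Birkhoff sums of `φ` of lengths `0, …, n`. -/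
def maxBirkhoffSum (f : X → X) (φ : X → ℝ) : ℕ → X → ℝ
  | 0, _ => 0
  | n + 1, x => max 0 (φ x + maxBirkhoffSum f φ n (f x))

omit [MeasurableSpace X] in
theorem birkhoffSum_le_maxBirkhoffSum (n : ℕ) (x : X) :
    birkhoffSum f φ n x ≤ maxBirkhoffSum f φ n x := by
  induction n generalizing x with
  | zero => simp [maxBirkhoffSum]
  | succ n ih =>
    rw [birkhoffSum_succ', maxBirkhoffSum]
    exact le_max_of_le_right (by gcongr; exact ih _)

omit [MeasurableSpace X] in
theorem maxBirkhoffSum_le_succ (n : ℕ) (x : X) :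
    maxBirkhoffSum f φ n x ≤ maxBirkhoffSum f φ (n + 1) x := by
  induction n generalizing x with
  | zero => exact le_max_left _ _
  | succ n ih =>
    rw [maxBirkhoffSum, maxBirkhoffSum]
    exact max_le_max le_rfl (by gcongr; exact ih _)

theorem measurable_maxBirkhoffSum (hf : Measurable f) (hφ : Measurable φ) (n : ℕ) :
    Measurable (maxBirkhoffSum f φ n) := by
  induction n with
  | zero => exact measurable_const
  | succ n ih => exact measurable_const.max (hφ.add (ih.comp hf))

theorem integrable_maxBirkhoffSum [IsFiniteMeasure μ] (hf : MeasurePreserving f μ μ)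
    (hφ : Integrable φ μ) (n : ℕ) : Integrable (maxBirkhoffSum f φ n) μ := by
  induction n with
  | zero => exact integrable_const 0
  | succ n ih => exact (integrable_const 0).sup (hφ.add (hf.integrable_comp_of_integrable ih))

theorem integral_indicator_maxBirkhoffSum_nonneg [IsFiniteMeasure μ]
    (hf : MeasurePreserving f μ μ) (hφm : Measurable φ) (hφ : Integrable φ μ) (n : ℕ) :
    0 ≤ ∫ x, {x | 0 < maxBirkhoffSum f φ n x}.indicator φ x ∂μ := by
  cases n with
  | zero => simp [maxBirkhoffSum]
  | succ n =>
    have hM := integrable_maxBirkhoffSum hf hφ (n + 1)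
    have hMf : Integrable (fun x => maxBirkhoffSum f φ (n + 1) (f x)) μ :=
      hf.integrable_comp_of_integrable hM
    have h0 : ∫ x, (maxBirkhoffSum f φ (n + 1) x - maxBirkhoffSum f φ (n + 1) (f x)) ∂μ = 0 := by
      have h1 : ∫ x, maxBirkhoffSum f φ (n + 1) (f x) ∂μ =
          ∫ x, maxBirkhoffSum f φ (n + 1) x ∂μ := by
        conv_rhs => rw [← hf.map_eq]
        rw [integral_map hf.measurable.aemeasurable]
        exact (measurable_maxBirkhoffSum hf.measurable hφm _).aestronglyMeasurable
      rw [integral_sub hM hMf, h1, sub_self]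
    refine h0.ge.trans ?_
    refine integral_mono (hM.sub hMf) (hφ.indicator
      (measurableSet_lt measurable_const (measurable_maxBirkhoffSum hf.measurable hφm _)))
      fun x => ?_
    have h2 := maxBirkhoffSum_le_succ (f := f) (φ := φ) n (f x)
    have h3 : 0 ≤ maxBirkhoffSum f φ (n + 1) (f x) := le_max_left _ _
    by_cases hx : 0 < maxBirkhoffSum f φ (n + 1) x
    · rw [Set.indicator_of_mem (by exact hx)]
      have h4 : maxBirkhoffSum f φ (n + 1) x = φ x + maxBirkhoffSum f φ n (f x) := by
        rw [maxBirkhoffSum] at hx ⊢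
        refine max_eq_right (le_of_lt ?_)
        simpa using hx
      linarith
    · rw [Set.indicator_of_notMem (by exact hx)]
      linarith

/-- Maximal ergodic inequality: if a.e. point has a positive Birkhoff sum of `φ`, then `φ` has
nonnegative mean. -/
theorem integral_nonneg_of_ae_exists_birkhoffSum_pos [IsFiniteMeasure μ]
    (hf : MeasurePreserving f μ μ) (hφm : Measurable φ) (hφ : Integrable φ μ)
    (h : ∀ᵐ x ∂μ, ∃ n, 0 < birkhoffSum f φ n x) : 0 ≤ ∫ x, φ x ∂μ := by
  refine ge_of_tendsto' (tendsto_integral_of_dominated_convergence (fun x => ‖φ x‖)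
    (fun n => ((hφm.indicator (measurableSet_lt measurable_const
      (measurable_maxBirkhoffSum hf.measurable hφm n))).aestronglyMeasurable)) hφ.norm
    (fun n => Filter.Eventually.of_forall fun x => norm_indicator_le_norm_self _ _) ?_)
    (integral_indicator_maxBirkhoffSum_nonneg hf hφm hφ)
  filter_upwards [h] with x ⟨n, hn⟩
  refine tendsto_const_nhds.congr' ?_
  filter_upwards [Filter.eventually_ge_atTop n] with m hm
  have h1 : 0 < maxBirkhoffSum f φ m x := hn.trans_le <|
    (birkhoffSum_le_maxBirkhoffSum n x).trans
      (monotone_nat_of_le_succ (fun k => maxBirkhoffSum_le_succ k x) hm)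
  rw [Set.indicator_of_mem (by exact h1)]

end Maximal

namespace FilterSystem

/-! ### Exponential decay of the cocycle and periodic points -/

section Ergodic

variable {X : Type*} [MeasurableSpace X] (S : FilterSystem X)

/-- The mean of `log |m₀|²` is negative, by Jensen's inequality. -/
theorem integral_log_neg (h0 : S.μ {x | S.m0 x = 0} = 0) (h1 : ¬ ∀ᵐ x ∂S.μ, ‖S.m0 x‖ = 1)
    (hlog : Integrable (fun x => Real.log (‖S.m0 x‖ ^ 2)) S.μ) :
    ∫ x, Real.log (‖S.m0 x‖ ^ 2) ∂S.μ < 0 := by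
  have hm : Measurable fun x => ‖S.m0 x‖ ^ 2 := S.measurable_m0.norm.pow_const 2
  have hl : ∫⁻ x, ENNReal.ofReal (‖S.m0 x‖ ^ 2) ∂S.μ = 1 := by
    rw [← S.lintegral_enorm_m0_sq]
    refine lintegral_congr fun x => ?_
    rw [ENNReal.ofReal_pow (norm_nonneg _), ofReal_norm]
  have hsq : Integrable (fun x => ‖S.m0 x‖ ^ 2) S.μ :=
    (lintegral_ofReal_ne_top_iff_integrable hm.aestronglyMeasurable
      (Filter.Eventually.of_forall fun x => by positivity)).1 (by rw [hl]; exact ENNReal.one_ne_top)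
  have hsq1 : ∫ x, ‖S.m0 x‖ ^ 2 ∂S.μ = 1 := by
    rw [integral_eq_lintegral_of_nonneg_ae (Filter.Eventually.of_forall fun x => by positivity)
      hm.aestronglyMeasurable, hl, ENNReal.toReal_one]
  have hne : ∀ᵐ x ∂S.μ, S.m0 x ≠ 0 := measure_eq_zero_iff_ae_notMem.1 h0
  have hnn : 0 ≤ᵐ[S.μ] fun x => ‖S.m0 x‖ ^ 2 - 1 - Real.log (‖S.m0 x‖ ^ 2) := by
    filter_upwards [hne] with x hx
    have : 0 < ‖S.m0 x‖ ^ 2 := by positivity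
    have := Real.log_le_sub_one_of_pos this
    simp only [Pi.zero_apply]
    linarith
  have hint : Integrable (fun x => ‖S.m0 x‖ ^ 2 - 1 - Real.log (‖S.m0 x‖ ^ 2)) S.μ :=
    (hsq.sub (integrable_const 1)).sub hlog
  have hval : ∫ x, (‖S.m0 x‖ ^ 2 - 1 - Real.log (‖S.m0 x‖ ^ 2)) ∂S.μ =
      - ∫ x, Real.log (‖S.m0 x‖ ^ 2) ∂S.μ := by
    have h2 : Integrable (fun x => ‖S.m0 x‖ ^ 2 - 1) S.μ := hsq.sub (integrable_const 1)
    rw [integral_sub h2 hlog, integral_sub hsq (integrable_const 1),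
      hsq1]
    simp
  by_contra! hge
  refine h1 ?_
  have hz := (integral_eq_zero_iff_of_nonneg_ae hnn hint).1
    (le_antisymm (by linarith) (integral_nonneg_of_ae hnn))
  filter_upwards [hz, hne] with x hx hx0
  have hp : 0 < ‖S.m0 x‖ ^ 2 := by positivity
  by_contra hx1
  have h2 : ‖S.m0 x‖ ^ 2 ≠ 1 := fun h => hx1 (by
    exact (pow_eq_one_iff_of_nonneg (norm_nonneg _) two_ne_zero).1 h)
  have := Real.log_lt_sub_one_of_pos hp h2
  simp only [Pi.zero_apply] at hx
  linarith

/-- The sum `∑_{n ≥ 0} ∏_{k < n} |m₀(r^k x)|²`. -/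
def forwardSum (x : X) : ℝ≥0∞ :=
  ∑' n : ℕ, ∏ k ∈ Finset.range n, ‖S.m0 (S.r^[k] x)‖ₑ ^ 2

theorem measurable_forwardSum : Measurable S.forwardSum :=
  Measurable.tsum fun _ => Finset.measurable_fun_prod _ fun k _ =>
    (S.measurable_m0.comp (S.measurable_r.iterate k)).enorm.pow_const 2

theorem forwardSum_eq (x : X) : S.forwardSum x = 1 + ‖S.m0 x‖ₑ ^ 2 * S.forwardSum (S.r x) := by
  rw [forwardSum, tsum_eq_zero_add' ENNReal.summable, forwardSum, ← ENNReal.tsum_mul_left]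
  simp only [Finset.range_zero, Finset.prod_empty, Finset.prod_range_succ',
    Function.iterate_succ_apply, Function.iterate_zero, id]
  simp only [mul_comm]

/-- The products `∏_{k < n} |m₀(r^k x)|²` are summable at a.e. point. Their sum is infinite on an
`r`-invariant set; were this set conull, then so would be the set of points with a positive
Birkhoff sum of `log |m₀|² + ε`, for `ε` so small that this function has negative mean. -/
theorem ae_forwardSum_ne_top (hergodic : Ergodic S.r S.μ) (h0 : S.μ {x | S.m0 x = 0} = 0)
    (h1 : ¬ ∀ᵐ x ∂S.μ, ‖S.m0 x‖ = 1)
    (hlog : Integrable (fun x => Real.log (‖S.m0 x‖ ^ 2)) S.μ) :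
    ∀ᵐ x ∂S.μ, S.forwardSum x ≠ ∞ := by
  have hne : ∀ᵐ x ∂S.μ, S.m0 x ≠ 0 := measure_eq_zero_iff_ae_notMem.1 h0
  have hA : MeasurableSet {x | S.forwardSum x = ∞} :=
    S.measurable_forwardSum (measurableSet_singleton _)
  have hinv : {x | S.forwardSum x = ∞} ≤ᵐ[S.μ] S.r ⁻¹' {x | S.forwardSum x = ∞} := by
    refine Filter.Eventually.of_forall fun x hx => ?_
    change S.forwardSum (S.r x) = ∞
    have hx' : S.forwardSum x = ∞ := hx
    by_contra hc
    rw [S.forwardSum_eq] at hx'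
    exact ENNReal.add_ne_top.2 ⟨ENNReal.one_ne_top,
      ENNReal.mul_ne_top (ENNReal.pow_ne_top enorm_ne_top) hc⟩ hx'
  rcases hergodic.ae_empty_or_univ_of_ae_le_preimage hA.nullMeasurableSet hinv with h | h
  · filter_upwards [h] with x hx
    exact fun hc => (Eq.mp hx hc).elim
  exfalso
  have hneg := S.integral_log_neg h0 h1 hlog
  set c := ∫ x, Real.log (‖S.m0 x‖ ^ 2) ∂S.μ with hc
  have hφm : Measurable fun x => Real.log (‖S.m0 x‖ ^ 2) + -c / 2 := by
    have := S.measurable_m0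
    fun_prop
  have hmean : ∫ x, (Real.log (‖S.m0 x‖ ^ 2) + -c / 2) ∂S.μ = c / 2 := by
    rw [integral_add hlog (integrable_const _), ← hc]
    simp
    ring
  have hmax := integral_nonneg_of_ae_exists_birkhoffSum_pos hergodic.toMeasurePreserving hφm
    (hlog.add (integrable_const _)) (by
    have hne' : ∀ᵐ x ∂S.μ, ∀ k : ℕ, S.m0 (S.r^[k] x) ≠ 0 := ae_all_iff.2 fun k =>
      (hergodic.toMeasurePreserving.iterate k).quasiMeasurePreserving.ae hne
    filter_upwards [h, hne'] with x hx hx0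
    have hx' : S.forwardSum x = ∞ := Eq.mpr hx trivial
    by_contra! hle
    -- If no Birkhoff sum of `log |m₀|² - c / 2` is positive then
    -- `∏_{k < n} |m₀(r^k x)|² ≤ exp(n c / 2)`, the terms of a convergent geometric series.
    refine absurd hx' (ne_top_of_le_ne_top ?_ (ENNReal.tsum_le_tsum (g := fun n : ℕ =>
      ENNReal.ofReal (Real.exp (c / 2)) ^ n) fun n => ?_))
    · rw [ENNReal.tsum_geometric]
      refine ENNReal.inv_ne_top.2 (tsub_pos_of_lt ?_).ne'
      rw [ENNReal.ofReal_lt_one, ← Real.exp_zero]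
      exact Real.exp_lt_exp.2 (by linarith)
    · have hn := hle n
      simp only [birkhoffSum, Finset.sum_add_distrib, Finset.sum_const, Finset.card_range,
        nsmul_eq_mul] at hn
      have e : ∏ k ∈ Finset.range n, ‖S.m0 (S.r^[k] x)‖ₑ ^ 2 =
          ENNReal.ofReal (Real.exp (∑ k ∈ Finset.range n, Real.log (‖S.m0 (S.r^[k] x)‖ ^ 2))) := by
        rw [Real.exp_sum, ENNReal.ofReal_prod_of_nonneg fun k _ => (Real.exp_pos _).le]
        refine Finset.prod_congr rfl fun k _ => ?_
        have := norm_pos_iff.2 (hx0 k)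
        rw [Real.exp_log (by positivity), ENNReal.ofReal_pow (norm_nonneg _), ofReal_norm]
      rw [e, ← ENNReal.ofReal_pow (Real.exp_pos _).le, ← Real.exp_nat_mul]
      exact ENNReal.ofReal_le_ofReal (Real.exp_le_exp.2 (by linarith)))
  rw [hmean] at hmax
  linarith

/-- Periodic points form a null set. Otherwise, by ergodicity, `r` would be periodic a.e., hence
a.e. injective, and the filter condition on one-point fibres would give `|m₀| = 1` a.e. -/
theorem measure_periodic_eq_zero [MeasurableEq X] (hergodic : Ergodic S.r S.μ)
    (h1 : ¬ ∀ᵐ x ∂S.μ, ‖S.m0 x‖ = 1) (p : ℕ) :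
    S.μ {x | S.r^[p + 1] x = x} = 0 := by
  have hA : MeasurableSet {x | S.r^[p + 1] x = x} :=
    measurableSet_eq_fun (S.measurable_r.iterate _) measurable_id
  have hinv : {x | S.r^[p + 1] x = x} ≤ᵐ[S.μ] S.r ⁻¹' {x | S.r^[p + 1] x = x} := by
    refine Filter.Eventually.of_forall fun x hx => ?_
    change S.r^[p + 1] (S.r x) = S.r x
    rw [← Function.iterate_succ_apply, Function.iterate_succ_apply' S.r (p + 1)]
    exact congrArg S.r hx
  rcases hergodic.ae_empty_or_univ_of_ae_le_preimage hA.nullMeasurableSet hinv with h | h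
  · exact (measure_congr h).trans measure_empty
  refine absurd ?_ h1
  have h2 : ∀ᵐ x ∂S.μ, S.r^[p + 1] x = x := h.mono fun x hx => Eq.mpr hx trivial
  have h3 : ∀ᵐ x ∂S.μ, ∀ y ∈ S.fiber (S.r x), S.r^[p + 1] y = y :=
    hergodic.toMeasurePreserving.quasiMeasurePreserving.ae (S.ae_forall_fiber h2)
  filter_upwards [h3] with x hx
  -- On points of period `p + 1` the map `r` is inverted by `r^p`.
  have hfib : S.fiber (S.r x) = {x} := by
    ext y
    rw [Finset.mem_singleton, S.mem_fiber]
    refine ⟨fun hy => ?_, fun hy => by rw [hy]⟩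
    rw [← hx y (S.mem_fiber.2 hy), ← hx x (S.mem_fiber.2 rfl), Function.iterate_succ_apply,
      Function.iterate_succ_apply, hy]
  have hq := S.qmf (S.r x)
  change _ * ∑ y ∈ S.fiber (S.r x), _ = _ at hq
  rw [← S.card_fiber, hfib] at hq
  simp only [Finset.card_singleton, Nat.cast_one, div_one, one_mul, Finset.sum_singleton] at hq
  exact (pow_eq_one_iff_of_nonneg (norm_nonneg _) two_ne_zero).1 hq

end Ergodic

/-! ### The cocycle on the solenoid -/

section Cocycle

variable {X : Type*} [MeasurableSpace X] (S : FilterSystem X)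

theorem zpow_apply_zpow (z : S.Solenoid) (n k : ℤ) :
    (S.rInf ^ n) ((S.rInf ^ k) z) = (S.rInf ^ (n + k)) z := by
  rw [zpow_add]; rfl

theorem orbit_zpow (z : S.Solenoid) (n k : ℤ) :
    S.orbit ((S.rInf ^ k) z) n = S.orbit z (n + k) := by
  rw [orbit, zpow_apply_zpow]; rfl

theorem orbit_natCast (z : S.Solenoid) (n : ℕ) : S.orbit z n = S.r^[n] (S.θ₀ z) := by
  induction n with
  | zero => rfl
  | succ n ih => rw [Nat.cast_succ, orbit_succ, ih, Function.iterate_succ_apply']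

theorem zpow_mem_regularSet {z : S.Solenoid} (hz : z ∈ S.regularSet) (k : ℤ) :
    (S.rInf ^ k) z ∈ S.regularSet := fun n => by
  rw [orbit_zpow]; exact hz _

theorem measurableSet_regularSet : MeasurableSet S.regularSet := by
  rw [regularSet, Set.ofPred_forall]
  exact MeasurableSet.iInter fun n =>
    (S.measurable_m0.comp (S.measurable_orbit n)) (measurableSet_singleton _).compl

@[simp] theorem mTilde_zero (z : S.Solenoid) : S.mTilde z 0 = 1 :=
  Finset.prod_range_zero _

theorem mTilde_succ' {z : S.Solenoid} (hz : z ∈ S.regularSet) (n : ℤ) :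
    S.mTilde z (n + 1) = S.mTilde z n * S.m0 (S.orbit z n) :=
  S.mTilde_succ ⟨z, hz⟩ n

theorem forwardSum_θ₀ (z : S.Solenoid) :
    S.forwardSum (S.θ₀ z) = ∑' n : ℕ, ‖S.mTilde z n‖ₑ ^ 2 := by
  refine tsum_congr fun n => ?_
  change _ = ‖∏ k ∈ Finset.range n, S.m0 (S.orbit z (k : ℤ))‖ₑ ^ 2
  simp only [orbit_natCast, ← ofReal_norm, norm_prod]
  rw [ENNReal.ofReal_prod_of_nonneg fun _ _ => norm_nonneg _, Finset.prod_pow]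

end Cocycle

/-! ### Quasi-invariance of `μ_∞` -/

section QuasiInvariant

variable {X : Type*} [MeasurableSpace X] [MeasurableEq X] [MeasurableSpace.CountablyGenerated X]
  (S : FilterSystem X)

omit [MeasurableEq X] [MeasurableSpace.CountablyGenerated X] in
theorem ae_m0_ne_zero (h0 : S.μ {x | S.m0 x = 0} = 0) : ∀ᵐ x ∂S.μ, S.m0 x ≠ 0 :=
  measure_eq_zero_iff_ae_notMem.1 h0

theorem ae_θ₀ {p : X → Prop} (hp : ∀ᵐ x ∂S.μ, p x) : ∀ᵐ z ∂S.μInf, p (S.θ₀ z) := by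
  have h := S.measurePreserving_θ₀.quasiMeasurePreserving.tendsto_ae
  exact h.eventually hp

theorem quasiMeasurePreserving_rInf (h0 : S.μ {x | S.m0 x = 0} = 0) :
    Measure.QuasiMeasurePreserving S.rInf S.μInf S.μInf := by
  refine ⟨S.measurable_rInf, Measure.AbsolutelyContinuous.mk fun N hN hN0 => ?_⟩
  rw [Measure.map_apply S.measurable_rInf hN]
  have h := S.lintegral_rInf (measurable_one.indicator hN)
  have hm : Measurable fun z => ‖S.m0 (S.θ₀ z)‖ₑ ^ 2 * N.indicator 1 (S.rInf z) :=
    ((S.measurable_m0.enorm.pow_const 2).comp S.measurable_θ₀).mul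
      ((measurable_one.indicator hN).comp S.measurable_rInf)
  rw [lintegral_indicator_one hN, hN0, lintegral_eq_zero_iff hm] at h
  have hne : ∀ᵐ z ∂S.μInf, S.m0 (S.θ₀ z) ≠ 0 :=
    S.ae_θ₀ (p := fun x => S.m0 x ≠ 0) (S.ae_m0_ne_zero h0)
  rw [measure_eq_zero_iff_ae_notMem]
  filter_upwards [h, hne] with z hz hz0 hzN
  have hzN' : S.rInf z ∈ N := hzN
  simp [hzN', hz0] at hz

theorem quasiMeasurePreserving_rInf_symm :
    Measure.QuasiMeasurePreserving S.rInf.symm S.μInf S.μInf := by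
  refine ⟨S.measurable_rInf_symm, Measure.AbsolutelyContinuous.mk fun N hN hN0 => ?_⟩
  rw [Measure.map_apply S.measurable_rInf_symm hN]
  have hN' := S.measurable_rInf_symm hN
  rw [← lintegral_indicator_one hN', ← S.lintegral_rInf (measurable_one.indicator hN')]
  have e : (fun z => ‖S.m0 (S.θ₀ z)‖ₑ ^ 2 * (S.rInf.symm ⁻¹' N).indicator 1 (S.rInf z)) =ᵐ[S.μInf]
      fun _ => 0 := by
    filter_upwards [measure_eq_zero_iff_ae_notMem.1 hN0] with z hz
    simp [hz]
  rw [lintegral_congr_ae e, lintegral_zero]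

theorem quasiMeasurePreserving_zpow (h0 : S.μ {x | S.m0 x = 0} = 0) (n : ℤ) :
    Measure.QuasiMeasurePreserving (S.rInf ^ n : Equiv.Perm S.Solenoid) S.μInf S.μInf := by
  cases n with
  | ofNat k =>
    change Measure.QuasiMeasurePreserving (S.rInf ^ k : Equiv.Perm S.Solenoid) _ _
    rw [Equiv.Perm.coe_pow]
    exact (S.quasiMeasurePreserving_rInf h0).iterate k
  | negSucc k =>
    rw [zpow_negSucc, ← inv_pow, Equiv.Perm.coe_pow]
    exact S.quasiMeasurePreserving_rInf_symm.iterate (k + 1)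

theorem ae_orbit (h0 : S.μ {x | S.m0 x = 0} = 0) {p : X → Prop} (hp : ∀ᵐ x ∂S.μ, p x) :
    ∀ᵐ z ∂S.μInf, ∀ n : ℤ, p (S.orbit z n) := by
  have h (n : ℤ) : ∀ᵐ z ∂S.μInf, p (S.θ₀ ((S.rInf ^ n) z)) :=
    (S.quasiMeasurePreserving_zpow h0 n).ae (p := fun z => p (S.θ₀ z)) (S.ae_θ₀ hp)
  exact ae_all_iff.2 h

theorem ae_mem_regularSet (h0 : S.μ {x | S.m0 x = 0} = 0) : ∀ᵐ z ∂S.μInf, z ∈ S.regularSet :=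
  S.ae_orbit (p := fun x => S.m0 x ≠ 0) h0 (S.ae_m0_ne_zero h0)

/-- The Radon–Nikodym relation `d(μ_∞ ∘ r_∞^n) = |m̃_n|² dμ_∞`. -/
theorem lintegral_zpow (h0 : S.μ {x | S.m0 x = 0} = 0) (n : ℤ) {G : S.Solenoid → ℝ≥0∞}
    (hG : Measurable G) :
    ∫⁻ z, ‖S.mTilde z n‖ₑ ^ 2 * G ((S.rInf ^ n) z) ∂S.μInf = ∫⁻ z, G z ∂S.μInf := by
  have hD : Measurable fun z => ‖S.m0 (S.θ₀ z)‖ₑ ^ 2 :=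
    (S.measurable_m0.enorm.pow_const 2).comp S.measurable_θ₀
  have hreg := S.ae_mem_regularSet h0
  induction n using Int.induction_on generalizing G with
  | zero => simp
  | succ n ih =>
    rw [← S.lintegral_rInf hG, ← ih (G := fun z => ‖S.m0 (S.θ₀ z)‖ₑ ^ 2 * G (S.rInf z))
      (hD.mul (hG.comp S.measurable_rInf))]
    refine lintegral_congr_ae ?_
    filter_upwards [hreg] with z hz
    have e : (S.rInf ^ ((n : ℤ) + 1)) z = S.rInf ((S.rInf ^ (n : ℤ)) z) := by
      rw [add_comm, zpow_add, zpow_one]; rfl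
    rw [S.mTilde_succ' hz, enorm_mul, mul_pow, e, mul_assoc]
    rfl
  | pred n ih =>
    have hD' := hD.comp S.measurable_rInf_symm
    have h1 := ih (G := fun w => (‖S.m0 (S.θ₀ (S.rInf.symm w))‖ₑ ^ 2)⁻¹ * G (S.rInf.symm w))
      (hD'.inv.mul (hG.comp S.measurable_rInf_symm))
    rw [← S.lintegral_rInf (G := fun w => (‖S.m0 (S.θ₀ (S.rInf.symm w))‖ₑ ^ 2)⁻¹ *
      G (S.rInf.symm w)) (hD'.inv.mul (hG.comp S.measurable_rInf_symm))] at h1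
    have hcancel : ∀ c : ℂ, c ≠ 0 → ∀ b : ℝ≥0∞, ‖c‖ₑ ^ 2 * ((‖c‖ₑ ^ 2)⁻¹ * b) = b := by
      intro c hc b
      rw [← mul_assoc, ENNReal.mul_inv_cancel, one_mul]
      · simpa using hc
      · exact ENNReal.pow_ne_top enorm_ne_top
    have h2 : ∫⁻ z, ‖S.m0 (S.θ₀ z)‖ₑ ^ 2 * ((‖S.m0 (S.θ₀ (S.rInf.symm (S.rInf z)))‖ₑ ^ 2)⁻¹ *
        G (S.rInf.symm (S.rInf z))) ∂S.μInf = ∫⁻ z, G z ∂S.μInf := by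
      refine lintegral_congr_ae ?_
      filter_upwards [hreg] with z hz
      rw [Equiv.symm_apply_apply]
      exact hcancel _ (hz 0) _
    rw [← h2, ← h1]
    refine lintegral_congr_ae ?_
    filter_upwards [hreg] with z hz
    have e : S.rInf.symm ((S.rInf ^ (-(n : ℤ))) z) = (S.rInf ^ (-(n : ℤ) - 1)) z := by
      rw [sub_eq_add_neg, add_comm, zpow_add, zpow_neg_one]; rfl
    have e1 := S.mTilde_succ' hz (-(n : ℤ) - 1)
    rw [sub_add_cancel] at e1
    rw [e, e1, enorm_mul, mul_pow, mul_assoc]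
    congr 1
    exact (hcancel _ (hz _) _).symm

end QuasiInvariant

/-! ### The fundamental domain -/

section Domain

variable {X : Type*} [MeasurableSpace X] (S : FilterSystem X)

/-- The least natural number that is not less than `∑_{n ≥ 0} |m̃_n(z)|²`, if this sum is finite
(and `0` otherwise). -/
def level (z : S.Solenoid) : ℕ := ⌈(S.forwardSum (S.θ₀ z)).toReal⌉₊

theorem measurable_level [MeasurableEq X] : Measurable S.level :=
  Nat.measurable_ceil.comp (S.measurable_forwardSum.comp S.measurable_θ₀).ennreal_toReal

/-- The regular points at which the level attains its minimum along the orbit for the first time.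
This set meets every orbit at most once, with no null set of exceptions. -/
def domain : Set S.Solenoid :=
  {z | z ∈ S.regularSet ∧ (∀ n : ℤ, S.level z ≤ S.level ((S.rInf ^ n) z)) ∧
    ∀ n : ℕ, S.level z < S.level ((S.rInf ^ (-((n : ℤ) + 1))) z)}

theorem measurableSet_domain [MeasurableEq X] : MeasurableSet S.domain := by
  refine S.measurableSet_regularSet.inter (MeasurableSet.inter ?_ ?_)
  · change MeasurableSet {z | ∀ n : ℤ, S.level z ≤ S.level ((S.rInf ^ n) z)}
    rw [Set.ofPred_forall]
    exact MeasurableSet.iInter fun n =>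
      measurableSet_le S.measurable_level (S.measurable_level.comp (S.measurable_rInf_zpow n))
  · change MeasurableSet {z | ∀ n : ℕ, S.level z < S.level ((S.rInf ^ (-((n : ℤ) + 1))) z)}
    rw [Set.ofPred_forall]
    exact MeasurableSet.iInter fun n =>
      measurableSet_lt S.measurable_level (S.measurable_level.comp (S.measurable_rInf_zpow _))

theorem eq_zero_of_zpow_mem_domain {z : S.Solenoid} (hz : z ∈ S.domain) {n : ℤ}
    (hn : (S.rInf ^ n) z ∈ S.domain) : n = 0 := by
  have key : ∀ w ∈ S.domain, ∀ k : ℕ, (S.rInf ^ ((k : ℤ) + 1)) w ∉ S.domain := by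
    intro w hw k hk
    have h1 := hk.2.2 k
    rw [zpow_apply_zpow, neg_add_cancel, zpow_zero] at h1
    exact absurd (hw.2.1 ((k : ℤ) + 1)) (not_le.2 h1)
  rcases lt_trichotomy n 0 with h | h | h
  · obtain ⟨k, rfl⟩ := Int.eq_negSucc_of_lt_zero h
    refine absurd ?_ (key _ hn k)
    rw [zpow_apply_zpow, Int.negSucc_eq, add_neg_cancel, zpow_zero]
    exact hz
  · exact h
  · obtain ⟨k, rfl⟩ := Int.eq_succ_of_zero_lt h
    exact absurd hn (key z hz k)

variable [MeasurableEq X] [MeasurableSpace.CountablyGenerated X]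

/-- A.e. point enters `{∑_{n ≥ 0} |m̃_n|² ≤ k}` only finitely often in backward time: the measures
of the images of this set under the `r_∞^n` add up to at most `k`. -/
theorem ae_finite_forwardSum_le (h0 : S.μ {x | S.m0 x = 0} = 0) (k : ℕ) :
    ∀ᵐ z ∂S.μInf, {n : ℕ | S.forwardSum (S.orbit z (-(n : ℤ))) ≤ k}.Finite := by
  have hE : MeasurableSet {z | S.forwardSum (S.θ₀ z) ≤ k} :=
    measurableSet_le (S.measurable_forwardSum.comp S.measurable_θ₀) measurable_const
  have hEn : ∀ n : ℕ, MeasurableSet {z | S.forwardSum (S.orbit z (-(n : ℤ))) ≤ k} := fun n =>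
    S.measurable_rInf_zpow (-(n : ℤ)) hE
  refine ae_finite_setOfPred_mem (s := fun n : ℕ => {z | S.forwardSum (S.orbit z (-(n : ℤ))) ≤ k})
    (ne_top_of_le_ne_top (ENNReal.natCast_ne_top k) ?_)
  have h : ∀ n : ℕ, S.μInf {z | S.forwardSum (S.orbit z (-(n : ℤ))) ≤ k} =
      ∫⁻ z in {z | S.forwardSum (S.θ₀ z) ≤ k}, ‖S.mTilde z n‖ₑ ^ 2 ∂S.μInf := by
    intro n
    rw [← lintegral_indicator_one (hEn n),
      ← S.lintegral_zpow h0 n (measurable_one.indicator (hEn n)), ← lintegral_indicator hE]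
    refine lintegral_congr fun z => ?_
    simp only [Set.indicator_apply, Set.mem_ofPred_eq, orbit_zpow, neg_add_cancel, Pi.one_apply]
    have : S.orbit z 0 = S.θ₀ z := rfl
    rw [this]
    split_ifs <;> simp
  simp only [h]
  rw [← lintegral_tsum fun n : ℕ => ((S.measurable_mTilde n).enorm.pow_const 2).aemeasurable]
  simp only [← forwardSum_θ₀]
  calc ∫⁻ z in {z | S.forwardSum (S.θ₀ z) ≤ k}, S.forwardSum (S.θ₀ z) ∂S.μInf
      ≤ ∫⁻ _ in {z | S.forwardSum (S.θ₀ z) ≤ k}, (k : ℝ≥0∞) ∂S.μInf :=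
        setLIntegral_mono measurable_const fun z hz => hz
    _ ≤ k := by
        rw [setLIntegral_const]
        exact mul_le_of_le_one_right zero_le prob_le_one

theorem ae_exists_zpow_mem_domain (h0 : S.μ {x | S.m0 x = 0} = 0)
    (hsum : ∀ᵐ x ∂S.μ, S.forwardSum x ≠ ∞) :
    ∀ᵐ z ∂S.μInf, ∃ n : ℤ, (S.rInf ^ n) z ∈ S.domain := by
  filter_upwards [S.ae_mem_regularSet h0, S.ae_orbit h0 hsum,
    ae_all_iff.2 fun k : ℕ => S.ae_finite_forwardSum_le h0 k] with z hz hfin hvis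
  obtain ⟨k, hk, hmin⟩ : ∃ k : ℕ, (∃ n : ℤ, S.level ((S.rInf ^ n) z) = k) ∧
      ∀ n : ℤ, k ≤ S.level ((S.rInf ^ n) z) :=
    ⟨sInf (Set.range fun n : ℤ => S.level ((S.rInf ^ n) z)),
      Nat.sInf_mem (Set.range_nonempty _), fun n => Nat.sInf_le ⟨n, rfl⟩⟩
  -- The minimum `k` is attained for a first time, as the level is at most `k` only finitely often
  -- in backward time.
  obtain ⟨b, hb⟩ := (hvis k).bddAbove
  obtain ⟨m, hm, hleast⟩ := Int.exists_least_of_bdd (P := fun n => S.level ((S.rInf ^ n) z) = k)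
    ⟨-(b : ℤ), fun n hn => by
      by_contra! hlt
      obtain ⟨j, rfl⟩ : ∃ j : ℕ, n = -(j : ℤ) := ⟨n.natAbs, by omega⟩
      have hj : j ∈ {n : ℕ | S.forwardSum (S.orbit z (-(n : ℤ))) ≤ k} := by
        have h1 : (S.forwardSum (S.orbit z (-(j : ℤ)))).toReal ≤ k :=
          (Nat.le_ceil _).trans (by exact_mod_cast hn.le)
        rw [Set.mem_ofPred_eq, ← ENNReal.ofReal_toReal (hfin (-(j : ℤ))), ← ENNReal.ofReal_natCast]
        exact ENNReal.ofReal_le_ofReal h1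
      have := hb hj
      omega⟩ hk
  refine ⟨m, S.zpow_mem_regularSet hz m, fun n => ?_, fun n => ?_⟩
  · rw [zpow_apply_zpow, hm]
    exact hmin _
  · rw [zpow_apply_zpow, hm]
    refine lt_of_le_of_ne (hmin _) fun h => ?_
    have := hleast _ h.symm
    omega

theorem isFundamentalDomain_domain (h0 : S.μ {x | S.m0 x = 0} = 0)
    (hsum : ∀ᵐ x ∂S.μ, S.forwardSum x ≠ ∞) : S.IsFundamentalDomain S.domain := by
  refine ⟨S.measurableSet_domain, ?_, fun n m hnm => ?_⟩
  · refine measure_eq_zero_iff_ae_notMem.2 ?_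
    filter_upwards [S.ae_exists_zpow_mem_domain h0 hsum] with z ⟨n, hn⟩
    rw [Set.notMem_compl_iff, Set.mem_iUnion]
    refine ⟨-n, _, hn, ?_⟩
    rw [zpow_apply_zpow, neg_add_cancel, zpow_zero]
    rfl
  · convert measure_empty (μ := S.μInf)
    rw [Set.eq_empty_iff_forall_notMem]
    rintro _ ⟨⟨z, hz, rfl⟩, w, hw, h⟩
    have hw' : w = (S.rInf ^ (-m + n)) z := by
      rw [← zpow_apply_zpow, ← h, zpow_apply_zpow, neg_add_cancel, zpow_zero]
      rfl
    have := S.eq_zero_of_zpow_mem_domain hz (hw' ▸ hw)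
    omega

end Domain

end FilterSystem

/-! ### The `L²` norm as a lower integral -/

/-- The square of the `L²` seminorm as a lower integral. -/
theorem eLpNorm_two_sq {Z : Type*} [MeasurableSpace Z] (f : Z → ℂ) (ν : Measure Z) :
    eLpNorm f 2 ν ^ 2 = ∫⁻ z, ‖f z‖ₑ ^ 2 ∂ν := by
  have h := eLpNorm_nnreal_pow_eq_lintegral (f := f) (p := 2) (μ := ν) two_ne_zero
  simpa using h

theorem memLp_two_iff_lintegral {Z : Type*} [MeasurableSpace Z] {f : Z → ℂ} {ν : Measure Z}
    (hf : AEStronglyMeasurable f ν) : MemLp f 2 ν ↔ ∫⁻ z, ‖f z‖ₑ ^ 2 ∂ν < ∞ := by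
  rw [← eLpNorm_two_sq, MemLp, ENNReal.pow_lt_top_iff]
  simp [hf]

theorem Lp_norm_sq_eq_lintegral {Z : Type*} [MeasurableSpace Z] {ν : Measure Z} (ξ : Lp ℂ 2 ν) :
    ‖ξ‖ ^ 2 = (∫⁻ z, ‖ξ z‖ₑ ^ 2 ∂ν).toReal := by
  rw [Lp.norm_def, ← ENNReal.toReal_pow, eLpNorm_two_sq]

theorem Lp_lintegral_lt_top {Z : Type*} [MeasurableSpace Z] {ν : Measure Z} (ξ : Lp ℂ 2 ν) :
    ∫⁻ z, ‖ξ z‖ₑ ^ 2 ∂ν < ∞ :=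
  (memLp_two_iff_lintegral (Lp.aestronglyMeasurable ξ)).1 (Lp.memLp ξ)

namespace FilterSystem

/-! ### Irreducibility of the component representations -/

section Irreducible

variable {X : Type*} [MeasurableSpace X] (S : FilterSystem X)

/-- The indicator function of a point. -/
def pointIndicator [MeasurableSingletonClass X] (x : X) : BoundedBorel X :=
  ⟨Set.indicator {x} 1, measurable_one.indicator (measurableSet_singleton x), 1, fun y => by
    by_cases h : y ∈ ({x} : Set X) <;> simp [h]⟩

/-- If the points `a_n(z)` are distinct then `[H_z, U_z, π_z]` is irreducible: multiplication by the
indicator of one of them is a rank one projection, and `U_z` permutes their ranges. -/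
theorem compRep_irreducible [MeasurableSingletonClass X] (z : S.regularSet)
    (hinj : Function.Injective (S.orbit z)) : (S.compRep z).Irreducible := by
  refine ⟨⟨WeightedL2.delta 0, 0, fun h => ?_⟩, fun K hK hU hU' hπ => ?_⟩
  · have := congrArg (fun ξ : S.compSpace z => ξ 0) h
    simp [WeightedL2.delta] at this
  rw [or_iff_not_imp_left]
  intro hne
  obtain ⟨ξ, hξK, hξ0⟩ := (Submodule.ne_bot_iff K).1 hne
  obtain ⟨n, hn⟩ : ∃ n, ξ n ≠ 0 := by
    by_contra! hc
    exact hξ0 (WeightedL2.ext hc)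
  have hδ : WeightedL2.delta n ∈ K := by
    have e : (S.compRep z).π (pointIndicator (S.orbit z n)) ξ = ξ n • WeightedL2.delta n := by
      apply WeightedL2.ext
      intro m
      change Set.indicator {S.orbit z n} (1 : X → ℂ) (S.orbit z m) * ξ m =
        ξ n * (Pi.single n 1 : ℤ → ℂ) m
      by_cases h : m = n
      · subst h; simp
      · rw [Set.indicator_of_notMem (by simpa using fun hc => h (hinj hc)), Pi.single_eq_of_ne h]
        simp
    have h := K.smul_mem (ξ n)⁻¹ (hπ (pointIndicator (S.orbit z n)) ξ hξK)
    rwa [e, inv_smul_smul₀ hn] at h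
  have hdown : ∀ m : ℤ, WeightedL2.delta m ∈ K → WeightedL2.delta (m - 1) ∈ K := by
    intro m hm
    have e : (S.compRep z).U (WeightedL2.delta m) =
        S.m0 (S.orbit z (m - 1)) • WeightedL2.delta (m - 1) := by
      apply WeightedL2.ext
      intro k
      change S.m0 (S.orbit z k) * (Pi.single m 1 : ℤ → ℂ) (k + 1) =
        S.m0 (S.orbit z (m - 1)) * (Pi.single (m - 1) 1 : ℤ → ℂ) k
      by_cases h : k = m - 1
      · subst h; simp
      · rw [Pi.single_eq_of_ne h, Pi.single_eq_of_ne (by omega), mul_zero, mul_zero]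
    have h := K.smul_mem (S.m0 (S.orbit z (m - 1)))⁻¹ (hU _ hm)
    rwa [e, inv_smul_smul₀ (z.2 _)] at h
  have hup : ∀ m : ℤ, WeightedL2.delta m ∈ K → WeightedL2.delta (m + 1) ∈ K := by
    intro m hm
    have e : (S.compRep z).U.symm (WeightedL2.delta m) =
        (S.m0 (S.orbit z m))⁻¹ • WeightedL2.delta (m + 1) := by
      apply WeightedL2.ext
      intro k
      change (S.m0 (S.orbit z (k - 1)))⁻¹ * (Pi.single m 1 : ℤ → ℂ) (k - 1) =
        (S.m0 (S.orbit z m))⁻¹ * (Pi.single (m + 1) 1 : ℤ → ℂ) k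
      by_cases h : k = m + 1
      · subst h; simp
      · rw [Pi.single_eq_of_ne h, Pi.single_eq_of_ne (by omega), mul_zero, mul_zero]
    have h := K.smul_mem (S.m0 (S.orbit z m)) (hU' _ hm)
    rwa [e, smul_inv_smul₀ (z.2 _)] at h
  have hall : ∀ m : ℤ, WeightedL2.delta m ∈ K := fun m =>
    Int.inductionOn' m n hδ (fun k _ hk => hup k hk) (fun k _ hk => hdown k hk)
  rw [← top_le_iff, ← WeightedL2.span_delta_dense]
  refine Submodule.topologicalClosure_minimal _ (Submodule.span_le.2 ?_) hK
  rintro _ ⟨m, rfl⟩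
  exact hall m

theorem orbit_add_natCast (z : S.Solenoid) (i : ℤ) (n : ℕ) :
    S.orbit z (i + n) = S.r^[n] (S.orbit z i) := by
  rw [add_comm, ← orbit_zpow, orbit_natCast]; rfl

theorem ae_injective_orbit [MeasurableEq X] [MeasurableSpace.CountablyGenerated X]
    (hergodic : Ergodic S.r S.μ) (h0 : S.μ {x | S.m0 x = 0} = 0)
    (h1 : ¬ ∀ᵐ x ∂S.μ, ‖S.m0 x‖ = 1) :
    ∀ᵐ z ∂S.μInf, Function.Injective (S.orbit z) := by
  have hper : ∀ᵐ x ∂S.μ, ∀ p : ℕ, S.r^[p + 1] x ≠ x := by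
    rw [ae_all_iff]
    intro p
    exact measure_eq_zero_iff_ae_notMem.1 (S.measure_periodic_eq_zero hergodic h1 p)
  filter_upwards [S.ae_orbit (p := fun x => ∀ p : ℕ, S.r^[p + 1] x ≠ x) h0 hper] with z hz
  have key : ∀ i j : ℤ, i < j → S.orbit z i ≠ S.orbit z j := by
    intro i j hij h
    obtain ⟨p, hp⟩ : ∃ p : ℕ, j = i + ((p + 1 : ℕ) : ℤ) := ⟨(j - i - 1).toNat, by omega⟩
    rw [hp, orbit_add_natCast] at h
    exact hz i p h.symm
  intro i j h
  rcases lt_trichotomy i j with hij | hij | hij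
  exacts [absurd h (key i j hij), hij, absurd h.symm (key j i hij)]

end Irreducible

/-! ### The wavelet representation -/

section Wavelet

variable {X : Type*} [MeasurableSpace X] [MeasurableEq X] [MeasurableSpace.CountablyGenerated X]
  (S : FilterSystem X)

omit [MeasurableEq X] [MeasurableSpace.CountablyGenerated X] in
theorem measurable_m0_θ₀ : Measurable fun z => S.m0 (S.θ₀ z) :=
  S.measurable_m0.comp S.measurable_θ₀

theorem lintegral_enorm_dilation (ξ : Lp ℂ 2 S.μInf) :
    ∫⁻ z, ‖S.m0 (S.θ₀ z) * ξ (S.rInf z)‖ₑ ^ 2 ∂S.μInf = ∫⁻ z, ‖ξ z‖ₑ ^ 2 ∂S.μInf := by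
  rw [← S.lintegral_rInf ((Lp.stronglyMeasurable ξ).measurable.enorm.pow_const 2)]
  simp only [enorm_mul, mul_pow]

theorem memLp_dilation (ξ : Lp ℂ 2 S.μInf) :
    MemLp (fun z => S.m0 (S.θ₀ z) * ξ (S.rInf z)) 2 S.μInf := by
  rw [memLp_two_iff_lintegral, S.lintegral_enorm_dilation]
  · exact Lp_lintegral_lt_top ξ
  · exact (S.measurable_m0_θ₀.mul
      ((Lp.stronglyMeasurable ξ).measurable.comp S.measurable_rInf)).aestronglyMeasurable

/-- The isometry `ξ ↦ (m₀ ∘ θ₀) (ξ ∘ r_∞)` of `L²(X_∞, μ_∞)`. -/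
def dilationIsometry (h0 : S.μ {x | S.m0 x = 0} = 0) : Lp ℂ 2 S.μInf →ₗᵢ[ℂ] Lp ℂ 2 S.μInf where
  toFun ξ := (S.memLp_dilation ξ).toLp
  map_add' ξ η := by
    apply Lp.ext
    filter_upwards [(S.memLp_dilation (ξ + η)).coeFn_toLp, (S.memLp_dilation ξ).coeFn_toLp,
      (S.memLp_dilation η).coeFn_toLp, Lp.coeFn_add (S.memLp_dilation ξ).toLp
        (S.memLp_dilation η).toLp,
      (S.quasiMeasurePreserving_rInf h0).ae_eq_comp (Lp.coeFn_add ξ η)] with z h1 h2 h3 h4 h5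
    simp only [Function.comp, Pi.add_apply] at h5
    rw [h1, h4, Pi.add_apply, h2, h3, h5, mul_add]
  map_smul' c ξ := by
    apply Lp.ext
    filter_upwards [(S.memLp_dilation (c • ξ)).coeFn_toLp, (S.memLp_dilation ξ).coeFn_toLp,
      Lp.coeFn_smul c (S.memLp_dilation ξ).toLp,
      (S.quasiMeasurePreserving_rInf h0).ae_eq_comp (Lp.coeFn_smul c ξ)] with z h1 h2 h3 h4
    simp only [Function.comp, Pi.smul_apply, smul_eq_mul] at h4
    rw [h1, RingHom.id_apply, h3, Pi.smul_apply, h2, h4, smul_eq_mul, mul_left_comm]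
  norm_map' ξ := by
    refine (sq_eq_sq₀ (norm_nonneg _) (norm_nonneg _)).1 ?_
    change ‖(S.memLp_dilation ξ).toLp‖ ^ 2 = ‖ξ‖ ^ 2
    rw [Lp_norm_sq_eq_lintegral, Lp_norm_sq_eq_lintegral, ← S.lintegral_enorm_dilation ξ]
    congr 1
    refine lintegral_congr_ae ?_
    filter_upwards [(S.memLp_dilation ξ).coeFn_toLp] with z hz
    rw [hz]

theorem dilationIsometry_apply (h0 : S.μ {x | S.m0 x = 0} = 0) (ξ : Lp ℂ 2 S.μInf) :
    S.dilationIsometry h0 ξ =ᵐ[S.μInf] fun z => S.m0 (S.θ₀ z) * ξ (S.rInf z) :=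
  (S.memLp_dilation ξ).coeFn_toLp

theorem dilationIsometry_surjective (h0 : S.μ {x | S.m0 x = 0} = 0) :
    Function.Surjective (S.dilationIsometry h0) := by
  intro η
  have hm : Measurable fun w => (S.m0 (S.θ₀ (S.rInf.symm w)))⁻¹ * η (S.rInf.symm w) :=
    (S.measurable_m0_θ₀.comp S.measurable_rInf_symm).inv.mul
      ((Lp.stronglyMeasurable η).measurable.comp S.measurable_rInf_symm)
  have hne : ∀ᵐ z ∂S.μInf, S.m0 (S.θ₀ z) ≠ 0 :=
    S.ae_θ₀ (p := fun x => S.m0 x ≠ 0) (S.ae_m0_ne_zero h0)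
  have hmem : MemLp (fun w => (S.m0 (S.θ₀ (S.rInf.symm w)))⁻¹ * η (S.rInf.symm w)) 2 S.μInf := by
    rw [memLp_two_iff_lintegral hm.aestronglyMeasurable,
      ← S.lintegral_rInf (hm.enorm.pow_const 2)]
    refine lt_of_eq_of_lt (lintegral_congr_ae ?_) (Lp_lintegral_lt_top η)
    filter_upwards [hne] with z hz
    rw [Equiv.symm_apply_apply, ← mul_pow, ← enorm_mul, mul_inv_cancel_left₀ hz]
  refine ⟨hmem.toLp, Lp.ext ?_⟩
  filter_upwards [S.dilationIsometry_apply h0 hmem.toLp, hne,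
    (S.quasiMeasurePreserving_rInf h0).ae_eq_comp hmem.coeFn_toLp] with z h1 h2 h3
  simp only [Function.comp, Equiv.symm_apply_apply] at h3
  rw [h1, h3, mul_inv_cancel_left₀ h2]

/-- The unitary `ξ ↦ (m₀ ∘ θ₀) (ξ ∘ r_∞)` of `L²(X_∞, μ_∞)`. -/
def dilation (h0 : S.μ {x | S.m0 x = 0} = 0) : Lp ℂ 2 S.μInf ≃ₗᵢ[ℂ] Lp ℂ 2 S.μInf :=
  LinearIsometryEquiv.ofSurjective (S.dilationIsometry h0) (S.dilationIsometry_surjective h0)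

theorem dilation_apply (h0 : S.μ {x | S.m0 x = 0} = 0) (ξ : Lp ℂ 2 S.μInf) :
    S.dilation h0 ξ =ᵐ[S.μInf] fun z => S.m0 (S.θ₀ z) * ξ (S.rInf z) :=
  S.dilationIsometry_apply h0 ξ

omit [MeasurableEq X] [MeasurableSpace.CountablyGenerated X] in
theorem memLp_mul (f : BoundedBorel X) (ξ : Lp ℂ 2 S.μInf) :
    MemLp (fun z => (f : X → ℂ) (S.θ₀ z) * ξ z) 2 S.μInf := by
  obtain ⟨C, hC⟩ := f.2.2
  refine (Lp.memLp ξ).of_le_mul (c := C)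
    ((f.2.1.comp S.measurable_θ₀).aestronglyMeasurable.mul (Lp.aestronglyMeasurable ξ))
    (Filter.Eventually.of_forall fun z => ?_)
  rw [norm_mul]
  exact mul_le_mul_of_nonneg_right (hC _) (norm_nonneg _)

/-- Multiplication by `f ∘ θ₀` on `L²(X_∞, μ_∞)`. -/
def multiplication (f : BoundedBorel X) : Lp ℂ 2 S.μInf →L[ℂ] Lp ℂ 2 S.μInf :=
  LinearMap.mkContinuousOfExistsBound
    { toFun := fun ξ => (S.memLp_mul f ξ).toLp
      map_add' := fun ξ η => by
        apply Lp.ext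
        filter_upwards [(S.memLp_mul f (ξ + η)).coeFn_toLp, (S.memLp_mul f ξ).coeFn_toLp,
          (S.memLp_mul f η).coeFn_toLp,
          Lp.coeFn_add (S.memLp_mul f ξ).toLp (S.memLp_mul f η).toLp,
          Lp.coeFn_add ξ η] with z h1 h2 h3 h4 h5
        rw [h1, h4, Pi.add_apply, h2, h3, h5, Pi.add_apply, mul_add]
      map_smul' := fun c ξ => by
        apply Lp.ext
        filter_upwards [(S.memLp_mul f (c • ξ)).coeFn_toLp, (S.memLp_mul f ξ).coeFn_toLp,
          Lp.coeFn_smul c (S.memLp_mul f ξ).toLp, Lp.coeFn_smul c ξ] with z h1 h2 h3 h4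
        rw [h1, RingHom.id_apply, h3, Pi.smul_apply, h2, h4, Pi.smul_apply, smul_eq_mul,
          smul_eq_mul, mul_left_comm] }
    (by
      obtain ⟨C, hC⟩ := f.2.2
      refine ⟨C, fun ξ => Lp.norm_le_mul_norm_of_ae_le_mul ?_⟩
      filter_upwards [(S.memLp_mul f ξ).coeFn_toLp] with z hz
      change ‖((S.memLp_mul f ξ).toLp) z‖ ≤ _
      rw [hz, norm_mul]
      exact mul_le_mul_of_nonneg_right (hC _) (norm_nonneg _))

omit [MeasurableEq X] [MeasurableSpace.CountablyGenerated X] in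
theorem multiplication_apply (f : BoundedBorel X) (ξ : Lp ℂ 2 S.μInf) :
    S.multiplication f ξ =ᵐ[S.μInf] fun z => (f : X → ℂ) (S.θ₀ z) * ξ z :=
  (S.memLp_mul f ξ).coeFn_toLp

theorem dilation_multiplication (h0 : S.μ {x | S.m0 x = 0} = 0) (f : BoundedBorel X)
    (η : Lp ℂ 2 S.μInf) : S.dilation h0 (S.multiplication f η) =
      S.multiplication (BoundedBorel.comp f S.r S.measurable_r) (S.dilation h0 η) := by
  apply Lp.ext
  have h : ∀ᵐ z ∂S.μInf, S.multiplication f η (S.rInf z) =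
      (f : X → ℂ) (S.θ₀ (S.rInf z)) * η (S.rInf z) :=
    (S.quasiMeasurePreserving_rInf h0).ae (p := fun z => S.multiplication f η z =
      (f : X → ℂ) (S.θ₀ z) * η z) (S.multiplication_apply f η)
  filter_upwards [S.dilation_apply h0 (S.multiplication f η), S.dilation_apply h0 η,
    S.multiplication_apply (BoundedBorel.comp f S.r S.measurable_r) (S.dilation h0 η), h]
    with z h1 h2 h3 h4
  rw [h1, h3, h2, h4]
  exact mul_left_comm _ _ _

theorem dilation_multiplication_symm (h0 : S.μ {x | S.m0 x = 0} = 0) (f : BoundedBorel X)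
    (ξ : Lp ℂ 2 S.μInf) : S.dilation h0 (S.multiplication f ((S.dilation h0).symm ξ)) =
      S.multiplication (BoundedBorel.comp f S.r S.measurable_r) ξ := by
  rw [dilation_multiplication, LinearIsometryEquiv.apply_symm_apply]

/-- The wavelet representation on `L²(X_∞, μ_∞)`. -/
def waveletRep (h0 : S.μ {x | S.m0 x = 0} = 0) :
    CovariantRep S.r S.measurable_r (Lp ℂ 2 S.μInf) where
  U := S.dilation h0
  π :=
    { toFun := S.multiplication
      map_one' := by
        ext1 ξ
        apply Lp.ext
        filter_upwards [S.multiplication_apply 1 ξ] with z hz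
        rw [hz]
        simp
      map_mul' := fun f g => by
        ext1 ξ
        apply Lp.ext
        filter_upwards [S.multiplication_apply (f * g) ξ, S.multiplication_apply g ξ,
          S.multiplication_apply f (S.multiplication g ξ)] with z h1 h2 h3
        rw [h1, mul_apply_eq_comp, h3, h2]
        simp [mul_assoc]
      map_zero' := by
        ext1 ξ
        apply Lp.ext
        filter_upwards [S.multiplication_apply 0 ξ, Lp.coeFn_zero ℂ 2 S.μInf] with z h1 h2
        rw [h1, zero_apply, h2]
        simp
      map_add' := fun f g => by
        ext1 ξ
        apply Lp.ext
        filter_upwards [S.multiplication_apply (f + g) ξ, S.multiplication_apply g ξ,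
          S.multiplication_apply f ξ,
          Lp.coeFn_add (S.multiplication f ξ) (S.multiplication g ξ)] with z h1 h2 h3 h4
        rw [h1, add_apply, h4, Pi.add_apply, h2, h3]
        simp [add_mul]
      commutes' := fun c => by
        ext1 ξ
        apply Lp.ext
        filter_upwards [S.multiplication_apply (algebraMap ℂ _ c) ξ, Lp.coeFn_smul c ξ]
          with z h1 h2
        have e : algebraMap ℂ (Lp ℂ 2 S.μInf →L[ℂ] Lp ℂ 2 S.μInf) c ξ = c • ξ := by
          rw [Algebra.algebraMap_eq_smul_one]; rfl
        rw [h1, e, h2]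
        simp [Algebra.algebraMap_eq_smul_one]
      map_star' := fun f => by
        rw [ContinuousLinearMap.star_eq_adjoint, ContinuousLinearMap.eq_adjoint_iff]
        intro ξ η
        rw [L2.inner_def, L2.inner_def]
        refine integral_congr_ae ?_
        filter_upwards [S.multiplication_apply (star f) ξ, S.multiplication_apply f η] with z h1 h2
        rw [h1, h2, RCLike.inner_apply', RCLike.inner_apply', map_mul]
        have : ((star f : BoundedBorel X) : X → ℂ) (S.θ₀ z) =
            starRingEnd ℂ ((f : X → ℂ) (S.θ₀ z)) := rfl
        rw [this, Complex.conj_conj]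
        ring }
  covariance := S.dilation_multiplication_symm h0

theorem isWaveletRep_waveletRep (h0 : S.μ {x | S.m0 x = 0} = 0) :
    S.IsWaveletRep (S.waveletRep h0) := by
  refine ⟨S.dilation_apply h0, S.multiplication_apply, fun f g hfg => ?_⟩
  ext1 ξ
  apply Lp.ext
  change S.multiplication f ξ =ᵐ[S.μInf] S.multiplication g ξ
  have hfg' : ∀ᵐ z ∂S.μInf, (f : X → ℂ) (S.θ₀ z) = (g : X → ℂ) (S.θ₀ z) :=
    S.ae_θ₀ (p := fun x => (f : X → ℂ) x = (g : X → ℂ) x) hfg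
  filter_upwards [S.multiplication_apply f ξ, S.multiplication_apply g ξ, hfg'] with z h1 h2 h3
  rw [h1, h2, h3]

end Wavelet

/-! ### Functions on the solenoid as sections over the fundamental domain -/

section Unfold

variable {X : Type*} [MeasurableSpace X] (S : FilterSystem X)

theorem domain_subset_regularSet : S.domain ⊆ S.regularSet := fun _ hz => hz.1

open Classical in
/-- The `n` with `r_∞^n w` in the fundamental domain, or `0` if there is none. -/
def returnTime (w : S.Solenoid) : ℤ :=
  if h : ∃ n : ℤ, (S.rInf ^ n) w ∈ S.domain then h.choose else 0

theorem returnTime_spec {w : S.Solenoid} (h : ∃ n : ℤ, (S.rInf ^ n) w ∈ S.domain) :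
    (S.rInf ^ S.returnTime w) w ∈ S.domain := by
  rw [returnTime, dif_pos h]
  exact h.choose_spec

theorem returnTime_eq {w : S.Solenoid} {n : ℤ} (h : (S.rInf ^ n) w ∈ S.domain) :
    S.returnTime w = n := by
  have h1 := S.returnTime_spec ⟨n, h⟩
  have h2 : (S.rInf ^ (S.returnTime w - n)) ((S.rInf ^ n) w) ∈ S.domain := by
    rwa [zpow_apply_zpow, sub_add_cancel]
  exact sub_eq_zero.1 (S.eq_zero_of_zpow_mem_domain h h2)

theorem zpow_neg_apply_zpow (z : S.Solenoid) (n : ℤ) : (S.rInf ^ (-n)) ((S.rInf ^ n) z) = z := by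
  rw [zpow_apply_zpow, neg_add_cancel, zpow_zero]; rfl

theorem returnTime_zpow {z : S.Solenoid} (hz : z ∈ S.domain) (n : ℤ) :
    S.returnTime ((S.rInf ^ n) z) = -n :=
  S.returnTime_eq (by rwa [zpow_neg_apply_zpow])

theorem measurable_returnTime [MeasurableEq X] : Measurable S.returnTime := by
  refine measurable_to_countable' fun n => ?_
  have hm : ∀ k : ℤ, MeasurableSet {w | (S.rInf ^ k) w ∈ S.domain} := fun k =>
    S.measurable_rInf_zpow k S.measurableSet_domain
  by_cases hn : n = 0
  · subst hn
    have e : S.returnTime ⁻¹' {0} = {w | (S.rInf ^ (0 : ℤ)) w ∈ S.domain} ∪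
        (⋃ k : ℤ, {w | (S.rInf ^ k) w ∈ S.domain})ᶜ := by
      ext w
      simp only [Set.mem_preimage, Set.mem_singleton_iff, Set.mem_union, Set.mem_compl_iff,
        Set.mem_iUnion, Set.mem_ofPred_eq]
      constructor
      · intro h
        rw [or_iff_not_imp_right, not_not]
        intro h1
        simpa [h] using S.returnTime_spec h1
      · rintro (h | h)
        · exact S.returnTime_eq h
        · exact dif_neg h
    rw [e]
    exact (hm 0).union (MeasurableSet.iUnion hm).compl
  · have e : S.returnTime ⁻¹' {n} = {w | (S.rInf ^ n) w ∈ S.domain} := by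
      ext w
      simp only [Set.mem_preimage, Set.mem_singleton_iff, Set.mem_ofPred_eq]
      refine ⟨fun h => ?_, S.returnTime_eq⟩
      rw [← h]
      refine S.returnTime_spec ?_
      by_contra hc
      exact hn (h.symm.trans (dif_neg hc))
    rw [e]
    exact hm n

/-- The point of the orbit of `w` in the fundamental domain. If there is none then this is `w`,
which is itself outside the fundamental domain. -/
def base (w : S.Solenoid) : S.Solenoid := (S.rInf ^ S.returnTime w) w

theorem measurable_base [MeasurableEq X] : Measurable S.base := by
  have h : Measurable fun p : ℤ × S.Solenoid => (S.rInf ^ p.1) p.2 :=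
    measurable_from_prod_countable_right fun n => S.measurable_rInf_zpow n
  exact h.comp (S.measurable_returnTime.prodMk measurable_id)

theorem base_zpow {z : S.Solenoid} (hz : z ∈ S.domain) (n : ℤ) : S.base ((S.rInf ^ n) z) = z := by
  rw [base, S.returnTime_zpow hz, zpow_neg_apply_zpow]

theorem exists_zpow_eq_of_base_mem {w : S.Solenoid} (hw : S.base w ∈ S.domain) :
    ∃ z ∈ S.domain, ∃ n : ℤ, w = (S.rInf ^ n) z :=
  ⟨S.base w, hw, -S.returnTime w, (S.zpow_neg_apply_zpow w _).symm⟩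

theorem lintegral_domainMeasure (G : S.Solenoid → ℝ≥0∞) :
    ∫⁻ z : S.regularSet, G z ∂(S.domainMeasure S.domain) = ∫⁻ z in S.domain, G z ∂S.μInf := by
  rw [domainMeasure, lintegral_subtype_comap S.measurableSet_regularSet,
    Measure.restrict_restrict S.measurableSet_regularSet,
    Set.inter_eq_right.2 S.domain_subset_regularSet]

theorem ae_domainMeasure_iff {p : S.Solenoid → Prop} :
    (∀ᵐ z : S.regularSet ∂(S.domainMeasure S.domain), p z) ↔
      ∀ᵐ z ∂(S.μInf.restrict S.domain), p z := by
  have hemb := MeasurableEmbedding.subtype_coe S.measurableSet_regularSet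
  have h := hemb.ae_map_iff (p := p) (μ := S.domainMeasure S.domain)
  rw [← h, domainMeasure, hemb.map_comap, Subtype.range_coe,
    Measure.restrict_restrict S.measurableSet_regularSet,
    Set.inter_eq_right.2 S.domain_subset_regularSet]

theorem ae_domainMeasure [MeasurableEq X] :
    ∀ᵐ z : S.regularSet ∂(S.domainMeasure S.domain), (z : S.Solenoid) ∈ S.domain :=
  S.ae_domainMeasure_iff.2 (ae_restrict_mem S.measurableSet_domain)

/-- Integration over the solenoid, orbit by orbit. -/
theorem lintegral_eq_lintegral_domain [MeasurableEq X] [MeasurableSpace.CountablyGenerated X]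
    (h0 : S.μ {x | S.m0 x = 0} = 0) (hsum : ∀ᵐ x ∂S.μ, S.forwardSum x ≠ ∞)
    {G : S.Solenoid → ℝ≥0∞} (hG : Measurable G) :
    ∫⁻ w, G w ∂S.μInf =
      ∫⁻ z in S.domain, ∑' n : ℤ, ‖S.mTilde z n‖ₑ ^ 2 * G ((S.rInf ^ n) z) ∂S.μInf := by
  have hind : Measurable (S.domain.indicator (1 : S.Solenoid → ℝ≥0∞)) :=
    measurable_one.indicator S.measurableSet_domain
  have hH : ∀ n : ℤ, Measurable fun w =>
      S.domain.indicator (1 : S.Solenoid → ℝ≥0∞) ((S.rInf ^ (-n)) w) * G w := fun n =>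
    (hind.comp (S.measurable_rInf_zpow (-n))).mul hG
  have hterm : ∀ n : ℤ, Measurable fun z => ‖S.mTilde z n‖ₑ ^ 2 * G ((S.rInf ^ n) z) := fun n =>
    ((S.measurable_mTilde n).enorm.pow_const 2).mul (hG.comp (S.measurable_rInf_zpow n))
  have h1 : ∀ n : ℤ, ∫⁻ w, S.domain.indicator 1 ((S.rInf ^ (-n)) w) * G w ∂S.μInf =
      ∫⁻ z in S.domain, ‖S.mTilde z n‖ₑ ^ 2 * G ((S.rInf ^ n) z) ∂S.μInf := by
    intro n
    rw [← S.lintegral_zpow h0 n (hH n), ← lintegral_indicator S.measurableSet_domain]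
    refine lintegral_congr fun z => ?_
    rw [zpow_neg_apply_zpow]
    by_cases hz : z ∈ S.domain <;> simp [hz]
  rw [lintegral_tsum fun n => (hterm n).aemeasurable]
  simp only [← h1]
  rw [← lintegral_tsum fun n => (hH n).aemeasurable]
  refine lintegral_congr_ae ?_
  filter_upwards [S.ae_exists_zpow_mem_domain h0 hsum] with w hw
  -- Exactly one translate of the fundamental domain contains `w`.
  rw [ENNReal.tsum_mul_right, tsum_eq_single (-S.returnTime w), neg_neg,
    Set.indicator_of_mem (S.returnTime_spec hw), Pi.one_apply, one_mul]
  intro n hn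
  refine Set.indicator_of_notMem (fun hc => hn ?_) _
  rw [S.returnTime_eq hc, neg_neg]

/-- The `n`-th coordinate of a section, extended by zero to the solenoid. -/
def extendCoord (η : ∀ z, S.compSpace z) (n : ℤ) : S.Solenoid → ℂ :=
  Function.extend Subtype.val (fun z => η z n) 0

theorem extendCoord_apply (η : ∀ z, S.compSpace z) (n : ℤ) (z : S.regularSet) :
    S.extendCoord η n z = η z n :=
  Subtype.val_injective.extend_apply _ _ _

theorem measurable_extendCoord {η : ∀ z, S.compSpace z} (hη : η ∈ S.compField.sections) (n : ℤ) :
    Measurable (S.extendCoord η n) :=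
  (MeasurableEmbedding.subtype_coe S.measurableSet_regularSet).measurable_extend (hη n)
    measurable_const

/-- The function on the solenoid whose value at `r_∞^n z`, for `z` in the fundamental domain, is the
`n`-th coordinate of `η z`. -/
def assemble (η : ∀ z, S.compSpace z) (w : S.Solenoid) : ℂ :=
  S.domain.indicator (fun z => S.extendCoord η (-S.returnTime w) z) (S.base w)

theorem assemble_zpow (η : ∀ z, S.compSpace z) (z : S.regularSet)
    (hz : (z : S.Solenoid) ∈ S.domain) (n : ℤ) : S.assemble η ((S.rInf ^ n) z) = η z n := by
  rw [assemble, S.base_zpow hz, Set.indicator_of_mem hz, S.returnTime_zpow hz, neg_neg,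
    extendCoord_apply]

theorem assemble_of_notMem (η : ∀ z, S.compSpace z) {w : S.Solenoid} (hw : S.base w ∉ S.domain) :
    S.assemble η w = 0 :=
  Set.indicator_of_notMem hw _

theorem measurable_assemble [MeasurableEq X] {η : ∀ z, S.compSpace z}
    (hη : η ∈ S.compField.sections) : Measurable (S.assemble η) := by
  have h : Measurable fun p : ℤ × S.Solenoid =>
      S.domain.indicator (fun z => S.extendCoord η (-p.1) z) p.2 :=
    measurable_from_prod_countable_right fun n =>
      (S.measurable_extendCoord hη (-n)).indicator S.measurableSet_domain
  exact h.comp (S.measurable_returnTime.prodMk S.measurable_base)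

/-- Pointwise identities between assembled functions may be checked on coordinates. -/
theorem assemble_induction {p : S.Solenoid → Prop} (h0 : ∀ w, S.base w ∉ S.domain → p w)
    (h : ∀ z : S.regularSet, (z : S.Solenoid) ∈ S.domain → ∀ n : ℤ, p ((S.rInf ^ n) z))
    (w : S.Solenoid) : p w := by
  by_cases hw : S.base w ∈ S.domain
  · obtain ⟨z, hz, n, rfl⟩ := S.exists_zpow_eq_of_base_mem hw
    exact h ⟨z, hz.1⟩ hz n
  · exact h0 w hw

theorem assemble_add (η ζ : ∀ z, S.compSpace z) :
    S.assemble (η + ζ) = S.assemble η + S.assemble ζ := by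
  funext w
  refine S.assemble_induction (p := fun w => S.assemble (η + ζ) w = (S.assemble η + S.assemble ζ) w)
    (fun w hw => ?_) (fun z hz n => ?_) w
  · simp [S.assemble_of_notMem _ hw]
  · simp [S.assemble_zpow _ z hz]

theorem assemble_smul (c : ℂ) (η : ∀ z, S.compSpace z) :
    S.assemble (c • η) = c • S.assemble η := by
  funext w
  refine S.assemble_induction (p := fun w => S.assemble (c • η) w = (c • S.assemble η) w)
    (fun w hw => ?_) (fun z hz n => ?_) w
  · simp [S.assemble_of_notMem _ hw]
  · simp [S.assemble_zpow _ z hz]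

theorem enorm_sq_compSpace (z : S.regularSet) (ξ : S.compSpace z) :
    ‖ξ‖ₑ ^ 2 = ∑' n : ℤ, ‖S.mTilde z n‖ₑ ^ 2 * ‖ξ n‖ₑ ^ 2 := by
  rw [← ofReal_norm, ← ENNReal.ofReal_pow (norm_nonneg _), WeightedL2.norm_sq_eq,
    ENNReal.ofReal_tsum_of_nonneg (fun n => by positivity) ξ.summable]
  refine tsum_congr fun n => ?_
  rw [ENNReal.ofReal_mul (by positivity), ENNReal.ofReal_pow (norm_nonneg _),
    ENNReal.ofReal_pow (norm_nonneg _), ofReal_norm, ofReal_norm, mul_comm]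
  rfl

variable [MeasurableEq X] [MeasurableSpace.CountablyGenerated X]

theorem lintegral_assemble (h0 : S.μ {x | S.m0 x = 0} = 0)
    (hsum : ∀ᵐ x ∂S.μ, S.forwardSum x ≠ ∞) {η : ∀ z, S.compSpace z}
    (hη : η ∈ S.compField.sections) :
    ∫⁻ w, ‖S.assemble η w‖ₑ ^ 2 ∂S.μInf = ∫⁻ z, ‖η z‖ₑ ^ 2 ∂(S.domainMeasure S.domain) := by
  rw [S.lintegral_eq_lintegral_domain h0 hsum ((S.measurable_assemble hη).enorm.pow_const 2),
    ← S.lintegral_domainMeasure]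
  refine lintegral_congr_ae ?_
  filter_upwards [S.ae_domainMeasure] with z hz
  rw [enorm_sq_compSpace]
  simp only [S.assemble_zpow η z hz]

end Unfold

/-! ### The unitary onto the direct integral -/

section Unitary

variable {X : Type*} [MeasurableSpace X] [MeasurableEq X] [MeasurableSpace.CountablyGenerated X]
  (S : FilterSystem X)

theorem memLp_assemble (h0 : S.μ {x | S.m0 x = 0} = 0)
    (hsum : ∀ᵐ x ∂S.μ, S.forwardSum x ≠ ∞)
    (η : MeasurableField.L2Section S.compField (S.domainMeasure S.domain)) :
    MemLp (S.assemble η.1) 2 S.μInf := by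
  rw [memLp_two_iff_lintegral (S.measurable_assemble η.2.1).aestronglyMeasurable,
    S.lintegral_assemble h0 hsum η.2.1]
  have h := η.2.2.2
  rw [hasFiniteIntegral_iff_enorm] at h
  simpa [enorm_pow] using h

omit [MeasurableEq X] [MeasurableSpace.CountablyGenerated X] in
theorem L2Section_norm_sq (η : MeasurableField.L2Section S.compField (S.domainMeasure S.domain)) :
    ‖η‖ ^ 2 = (∫⁻ z, ‖η z‖ₑ ^ 2 ∂(S.domainMeasure S.domain)).toReal := by
  rw [InnerProductSpace.norm_sq_eq_re_inner (𝕜 := ℂ), MeasurableField.L2Section.inner_def]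
  have h : (∫ z, inner ℂ (η z) (η z) ∂(S.domainMeasure S.domain))
      = ((∫ z, ‖η z‖ ^ 2 ∂(S.domainMeasure S.domain) : ℝ) : ℂ) := by
    rw [← integral_complex_ofReal]
    simp [inner_self_eq_norm_sq_to_K]
  rw [h]
  change (∫ z, ‖η z‖ ^ 2 ∂(S.domainMeasure S.domain) : ℝ) = _
  rw [integral_eq_lintegral_of_nonneg_ae (Filter.Eventually.of_forall fun z => sq_nonneg _)
    η.2.2.1]
  simp only [ENNReal.ofReal_pow (norm_nonneg _), ofReal_norm]

/-- `assemble` as an isometry from the square-integrable sections to `L²(X_∞, μ_∞)`. -/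
def assembleIsometry (h0 : S.μ {x | S.m0 x = 0} = 0) (hsum : ∀ᵐ x ∂S.μ, S.forwardSum x ≠ ∞) :
    MeasurableField.L2Section S.compField (S.domainMeasure S.domain) →ₗᵢ[ℂ] Lp ℂ 2 S.μInf where
  toFun η := (S.memLp_assemble h0 hsum η).toLp
  map_add' η ζ := by
    rw [← MemLp.toLp_add]
    exact MemLp.toLp_congr _ _ (Filter.EventuallyEq.of_eq (S.assemble_add η.1 ζ.1))
  map_smul' c η := by
    rw [RingHom.id_apply, ← MemLp.toLp_const_smul]
    exact MemLp.toLp_congr _ _ (Filter.EventuallyEq.of_eq (S.assemble_smul c η.1))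
  norm_map' η := by
    refine (sq_eq_sq₀ (norm_nonneg _) (norm_nonneg _)).1 ?_
    change ‖(S.memLp_assemble h0 hsum η).toLp‖ ^ 2 = ‖η‖ ^ 2
    rw [Lp_norm_sq_eq_lintegral, L2Section_norm_sq, ← S.lintegral_assemble h0 hsum η.2.1]
    congr 1
    refine lintegral_congr_ae ?_
    filter_upwards [(S.memLp_assemble h0 hsum η).coeFn_toLp] with z hz
    rw [hz]

theorem assembleIsometry_apply (h0 : S.μ {x | S.m0 x = 0} = 0)
    (hsum : ∀ᵐ x ∂S.μ, S.forwardSum x ≠ ∞)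
    (η : MeasurableField.L2Section S.compField (S.domainMeasure S.domain)) :
    S.assembleIsometry h0 hsum η =ᵐ[S.μInf] S.assemble η.1 :=
  (S.memLp_assemble h0 hsum η).coeFn_toLp

open Classical in
/-- The section whose coordinates are the values of `ξ` along the orbits, or zero on the orbits on
which these values are not square-summable. -/
def orbitSection (ξ : S.Solenoid → ℂ) (z : S.regularSet) : S.compSpace z :=
  if h : Summable fun n : ℤ => ‖ξ ((S.rInf ^ n) z)‖ ^ 2 * ‖(S.mTildeUnit z n : ℂ)‖ ^ 2 then
    WeightedL2.mk (fun n => ξ ((S.rInf ^ n) z)) h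
  else 0

omit [MeasurableEq X] [MeasurableSpace.CountablyGenerated X] in
theorem summable_orbit_iff (ξ : S.Solenoid → ℂ) (z : S.regularSet) :
    (Summable fun n : ℤ => ‖ξ ((S.rInf ^ n) z)‖ ^ 2 * ‖(S.mTildeUnit z n : ℂ)‖ ^ 2) ↔
      ∑' n : ℤ, ‖S.mTilde z n‖ₑ ^ 2 * ‖ξ ((S.rInf ^ n) z)‖ₑ ^ 2 ≠ ∞ := by
  have e : ∀ n : ℤ, ‖S.mTilde z n‖ₑ ^ 2 * ‖ξ ((S.rInf ^ n) z)‖ₑ ^ 2 =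
      ENNReal.ofReal (‖ξ ((S.rInf ^ n) z)‖ ^ 2 * ‖(S.mTildeUnit z n : ℂ)‖ ^ 2) := by
    intro n
    rw [ENNReal.ofReal_mul (by positivity), ENNReal.ofReal_pow (norm_nonneg _),
      ENNReal.ofReal_pow (norm_nonneg _), ofReal_norm, ofReal_norm, mul_comm]
    rfl
  simp only [e]
  refine ⟨fun h => h.tsum_ofReal_ne_top, fun h => ?_⟩
  refine (ENNReal.summable_toReal h).congr fun n => ?_
  exact ENNReal.toReal_ofReal (by positivity)

omit [MeasurableEq X] [MeasurableSpace.CountablyGenerated X] in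
theorem orbitSection_mem_sections {ξ : S.Solenoid → ℂ} (hξ : Measurable ξ) :
    S.orbitSection ξ ∈ S.compField.sections := by
  intro n
  have hs : MeasurableSet {z : S.regularSet |
      ∑' n : ℤ, ‖S.mTilde z n‖ₑ ^ 2 * ‖ξ ((S.rInf ^ n) z)‖ₑ ^ 2 ≠ ∞} := by
    have h : Measurable fun z : S.Solenoid =>
        ∑' n : ℤ, ‖S.mTilde z n‖ₑ ^ 2 * ‖ξ ((S.rInf ^ n) z)‖ₑ ^ 2 :=
      Measurable.tsum fun n => ((S.measurable_mTilde n).enorm.pow_const 2).mul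
        ((hξ.comp (S.measurable_rInf_zpow n)).enorm.pow_const 2)
    exact (h.comp measurable_subtype_coe) (measurableSet_singleton ∞).compl
  have e : (fun z : S.regularSet => S.orbitSection ξ z n) =
      Set.indicator {z : S.regularSet |
        ∑' n : ℤ, ‖S.mTilde z n‖ₑ ^ 2 * ‖ξ ((S.rInf ^ n) z)‖ₑ ^ 2 ≠ ∞}
        fun z => ξ ((S.rInf ^ n) z) := by
    funext z
    rw [orbitSection]
    by_cases h : Summable fun n : ℤ =>
        ‖ξ ((S.rInf ^ n) z)‖ ^ 2 * ‖(S.mTildeUnit z n : ℂ)‖ ^ 2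
    · rw [dif_pos h, Set.indicator_of_mem (by exact (S.summable_orbit_iff ξ z).1 h),
        WeightedL2.mk_apply]
    · rw [dif_neg h, Set.indicator_of_notMem (fun hc => h ((S.summable_orbit_iff ξ z).2 hc)),
        WeightedL2.zero_apply]
  rw [e]
  exact ((hξ.comp (S.measurable_rInf_zpow n)).comp measurable_subtype_coe).indicator hs

omit [MeasurableEq X] [MeasurableSpace.CountablyGenerated X] in
theorem enorm_sq_orbitSection_le (ξ : S.Solenoid → ℂ) (z : S.regularSet) :
    ‖S.orbitSection ξ z‖ₑ ^ 2 ≤ ∑' n : ℤ, ‖S.mTilde z n‖ₑ ^ 2 * ‖ξ ((S.rInf ^ n) z)‖ₑ ^ 2 := by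
  rw [orbitSection]
  split_ifs with h
  · rw [enorm_sq_compSpace]
    rfl
  · simp

theorem assembleIsometry_surjective (h0 : S.μ {x | S.m0 x = 0} = 0)
    (hsum : ∀ᵐ x ∂S.μ, S.forwardSum x ≠ ∞) :
    Function.Surjective (S.assembleIsometry h0 hsum) := by
  intro ξ
  have hξ : Measurable ξ := (Lp.stronglyMeasurable ξ).measurable
  have hfin := Lp_lintegral_lt_top ξ
  rw [S.lintegral_eq_lintegral_domain h0 hsum (hξ.enorm.pow_const 2)] at hfin
  have hmem := S.orbitSection_mem_sections hξ
  have hint : Integrable (fun z => ‖S.orbitSection ξ z‖ ^ 2) (S.domainMeasure S.domain) := by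
    refine ⟨((S.compField.measurable_norm _ hmem).pow_const 2).aestronglyMeasurable, ?_⟩
    rw [hasFiniteIntegral_iff_enorm]
    simp only [enorm_pow, enorm_norm]
    refine lt_of_le_of_lt (lintegral_mono fun z => S.enorm_sq_orbitSection_le ξ z) ?_
    rwa [S.lintegral_domainMeasure fun z => ∑' n : ℤ, ‖S.mTilde z n‖ₑ ^ 2 *
      ‖ξ ((S.rInf ^ n) z)‖ₑ ^ 2]
  refine ⟨⟨S.orbitSection ξ, hmem, hint⟩, Lp.ext ?_⟩
  have hT : Measurable fun z : S.Solenoid =>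
      ∑' n : ℤ, ‖S.mTilde z n‖ₑ ^ 2 * ‖ξ ((S.rInf ^ n) z)‖ₑ ^ 2 :=
    Measurable.tsum fun n => ((S.measurable_mTilde n).enorm.pow_const 2).mul
      ((hξ.comp (S.measurable_rInf_zpow n)).enorm.pow_const 2)
  have hgood : ∀ᵐ z ∂S.μInf, z ∈ S.domain →
      ∑' n : ℤ, ‖S.mTilde z n‖ₑ ^ 2 * ‖ξ ((S.rInf ^ n) z)‖ₑ ^ 2 ≠ ∞ :=
    (ae_restrict_iff' S.measurableSet_domain).1
      ((ae_lt_top hT hfin.ne).mono fun z hz => hz.ne)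
  have hgood' : ∀ᵐ w ∂S.μInf, ∀ k : ℤ, (S.rInf ^ k) w ∈ S.domain →
      ∑' n : ℤ, ‖S.mTilde ((S.rInf ^ k) w) n‖ₑ ^ 2 *
        ‖ξ ((S.rInf ^ n) ((S.rInf ^ k) w))‖ₑ ^ 2 ≠ ∞ :=
    ae_all_iff.2 fun k => (S.quasiMeasurePreserving_zpow h0 k).ae (p := fun z => z ∈ S.domain →
      ∑' n : ℤ, ‖S.mTilde z n‖ₑ ^ 2 * ‖ξ ((S.rInf ^ n) z)‖ₑ ^ 2 ≠ ∞) hgood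
  filter_upwards [S.assembleIsometry_apply h0 hsum ⟨S.orbitSection ξ, hmem, hint⟩, hgood',
    S.ae_exists_zpow_mem_domain h0 hsum] with w h1 h2 h3
  rw [h1]
  obtain ⟨z, hz, n, rfl⟩ := S.exists_zpow_eq_of_base_mem (S.returnTime_spec h3)
  have h4 := h2 (-n) (by rwa [zpow_neg_apply_zpow])
  rw [zpow_neg_apply_zpow] at h4
  refine (S.assemble_zpow _ ⟨z, hz.1⟩ hz n).trans ?_
  rw [orbitSection, dif_pos ((S.summable_orbit_iff ξ ⟨z, hz.1⟩).2 h4), WeightedL2.mk_apply]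

/-- The unitary from the direct integral over the fundamental domain onto `L²(X_∞, μ_∞)`. -/
def directIntegralEquiv (h0 : S.μ {x | S.m0 x = 0} = 0)
    (hsum : ∀ᵐ x ∂S.μ, S.forwardSum x ≠ ∞) :
    S.compField.DirectIntegral (S.domainMeasure S.domain) ≃ₗᵢ[ℂ] Lp ℂ 2 S.μInf :=
  LinearIsometryEquiv.ofSurjective
    { toLinearMap := (SeparationQuotient.liftCLM (S.assembleIsometry h0 hsum).toContinuousLinearMap
        fun _ _ h => (h.map (S.assembleIsometry h0 hsum).continuous).eq).toLinearMap
      norm_map' := fun v => by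
        obtain ⟨η, rfl⟩ := SeparationQuotient.surjective_mk v
        exact (S.assembleIsometry h0 hsum).norm_map η }
    fun ξ => (S.assembleIsometry_surjective h0 hsum ξ).imp' SeparationQuotient.mk fun _ h => h

theorem directIntegralEquiv_mk (h0 : S.μ {x | S.m0 x = 0} = 0)
    (hsum : ∀ᵐ x ∂S.μ, S.forwardSum x ≠ ∞)
    (η : MeasurableField.L2Section S.compField (S.domainMeasure S.domain)) :
    S.directIntegralEquiv h0 hsum (MeasurableField.DirectIntegral.mk _ _ η) =ᵐ[S.μInf]
      S.assemble η.1 :=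
  S.assembleIsometry_apply h0 hsum η

/-- An operator `T` of `L²(X_∞, μ_∞)` decomposes into the operators `t z` if it does so on
assembled functions. -/
theorem isFibrewise_of_assemble (h0 : S.μ {x | S.m0 x = 0} = 0)
    (hsum : ∀ᵐ x ∂S.μ, S.forwardSum x ≠ ∞) (T : Lp ℂ 2 S.μInf → Lp ℂ 2 S.μInf)
    (t : ∀ z, S.compSpace z → S.compSpace z)
    (hmeas : ∀ ξ ∈ S.compField.sections, (fun z => t z (ξ z)) ∈ S.compField.sections)
    (hbound : ∃ C : ℝ, ∀ z ξ, ‖t z ξ‖ ≤ C * ‖ξ‖)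
    (hT : ∀ ξ : Lp ℂ 2 S.μInf, ∀ η : ∀ z, S.compSpace z, ξ =ᵐ[S.μInf] S.assemble η →
      T ξ =ᵐ[S.μInf] S.assemble fun z => t z (η z)) :
    S.compField.IsFibrewise (S.domainMeasure S.domain)
      (fun v => (S.directIntegralEquiv h0 hsum).symm (T (S.directIntegralEquiv h0 hsum v))) t := by
  intro ξ
  obtain ⟨C, hC⟩ := hbound
  have hm := hmeas ξ.1 ξ.2.1
  have hi : Integrable (fun z => ‖t z (ξ z)‖ ^ 2) (S.domainMeasure S.domain) := by
    refine (ξ.2.2.const_mul (C ^ 2)).mono'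
      ((S.compField.measurable_norm _ hm).pow_const 2).aestronglyMeasurable
      (Filter.Eventually.of_forall fun z => ?_)
    rw [Real.norm_of_nonneg (by positivity), ← mul_pow]
    exact pow_le_pow_left₀ (norm_nonneg _) (hC z _) 2
  refine ⟨⟨fun z => t z (ξ z), hm, hi⟩, Filter.Eventually.of_forall fun z => rfl, ?_⟩
  have e1 := hT _ _ (S.directIntegralEquiv_mk h0 hsum ξ)
  have e2 := S.directIntegralEquiv_mk h0 hsum ⟨fun z => t z (ξ z), hm, hi⟩
  exact (LinearIsometryEquiv.symm_apply_eq _).2 (Lp.ext (e1.trans e2.symm))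

theorem isFibrewise_dilation (h0 : S.μ {x | S.m0 x = 0} = 0)
    (hsum : ∀ᵐ x ∂S.μ, S.forwardSum x ≠ ∞) :
    S.compField.IsFibrewise (S.domainMeasure S.domain)
      (fun v => (S.directIntegralEquiv h0 hsum).symm
        (S.dilation h0 (S.directIntegralEquiv h0 hsum v))) (fun z => S.compU z) := by
  refine S.isFibrewise_of_assemble h0 hsum (S.dilation h0) _ (fun ξ hξ n => ?_)
    ⟨1, fun z ξ => by rw [LinearIsometryEquiv.norm_map, one_mul]⟩ fun ξ η h => ?_
  · exact ((S.measurable_m0.comp (S.measurable_orbit n)).comp measurable_subtype_coe).mul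
      (hξ (n + 1))
  · have hr : ∀ᵐ w ∂S.μInf, ξ (S.rInf w) = S.assemble η (S.rInf w) :=
      (S.quasiMeasurePreserving_rInf h0).ae (p := fun w => ξ w = S.assemble η w) h
    filter_upwards [S.dilation_apply h0 ξ, hr, S.ae_exists_zpow_mem_domain h0 hsum]
      with w h1 h2 h3
    rw [h1, h2]
    obtain ⟨z, hz, n, rfl⟩ := S.exists_zpow_eq_of_base_mem (S.returnTime_spec h3)
    have e : S.rInf ((S.rInf ^ n) z) = (S.rInf ^ (n + 1)) z := by
      rw [add_comm, zpow_add, zpow_one]; rfl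
    rw [e, S.assemble_zpow η ⟨z, hz.1⟩ hz, S.assemble_zpow _ ⟨z, hz.1⟩ hz]
    rfl

theorem isFibrewise_multiplication (h0 : S.μ {x | S.m0 x = 0} = 0)
    (hsum : ∀ᵐ x ∂S.μ, S.forwardSum x ≠ ∞) (f : BoundedBorel X) :
    S.compField.IsFibrewise (S.domainMeasure S.domain)
      (fun v => (S.directIntegralEquiv h0 hsum).symm
        (S.multiplication f (S.directIntegralEquiv h0 hsum v))) (fun z => S.compπOp z f) := by
  refine S.isFibrewise_of_assemble h0 hsum (S.multiplication f) _ (fun ξ hξ n => ?_) ?_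
    fun ξ η h => ?_
  · exact ((f.2.1.comp (S.measurable_orbit n)).comp measurable_subtype_coe).mul (hξ n)
  · obtain ⟨C, hC⟩ := f.2.2
    refine ⟨C, fun z ξ => ?_⟩
    have hC0 : 0 ≤ C := (norm_nonneg _).trans (hC (S.orbit z 0))
    rw [← sq_le_sq₀ (norm_nonneg _) (by positivity), mul_pow, WeightedL2.norm_sq_eq,
      WeightedL2.norm_sq_eq, ← tsum_mul_left]
    refine Summable.tsum_le_tsum (fun n => ?_) (S.compπOp z f ξ).summable (ξ.summable.mul_left _)
    rw [compπOp_apply, norm_mul, mul_pow, mul_assoc]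
    have := hC (S.orbit z n)
    gcongr
  · filter_upwards [S.multiplication_apply f ξ, h, S.ae_exists_zpow_mem_domain h0 hsum]
      with w h1 h2 h3
    rw [h1, h2]
    obtain ⟨z, hz, n, rfl⟩ := S.exists_zpow_eq_of_base_mem (S.returnTime_spec h3)
    rw [S.assemble_zpow η ⟨z, hz.1⟩ hz, S.assemble_zpow _ ⟨z, hz.1⟩ hz]
    rfl

theorem isDirectIntegralOver_domain (h0 : S.μ {x | S.m0 x = 0} = 0)
    (hsum : ∀ᵐ x ∂S.μ, S.forwardSum x ≠ ∞) :
    S.IsDirectIntegralOver S.domain (S.waveletRep h0) :=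
  ⟨(S.directIntegralEquiv h0 hsum).symm, S.isFibrewise_dilation h0 hsum,
    S.isFibrewise_multiplication h0 hsum⟩

end Unitary

end FilterSystem

end

theorem theorem3p3 {X : Type*} [MetricSpace X] [CompactSpace X] [MeasurableSpace X] [BorelSpace X]
    (S : FilterSystem X)
    (hergodic : Ergodic S.r S.μ)
    (hnonsingular : S.μ {x | S.m0 x = 0} = 0)
    (hnotone : ¬ ∀ᵐ x ∂S.μ, ‖S.m0 x‖ = 1)
    (hlog : Integrable (fun x => Real.log (‖S.m0 x‖ ^ 2)) S.μ) :
    ∃ R : CovariantRep S.r S.measurable_r (Lp ℂ 2 S.μInf), S.IsWaveletRep R ∧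
      ∃ F : Set S.Solenoid, S.IsFundamentalDomain F ∧
        S.IsDirectIntegralOver F R ∧
        ∀ᵐ z ∂(S.μInf.restrict F), ∃ hz : z ∈ S.regularSet, (S.compRep ⟨z, hz⟩).Irreducible := by
  have hsum := S.ae_forwardSum_ne_top hergodic hnonsingular hnotone hlog
  refine ⟨S.waveletRep hnonsingular, S.isWaveletRep_waveletRep hnonsingular, S.domain,
    S.isFundamentalDomain_domain hnonsingular hsum,
    S.isDirectIntegralOver_domain hnonsingular hsum, ?_⟩
  filter_upwards [ae_restrict_mem S.measurableSet_domain,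
    ae_restrict_of_ae (S.ae_injective_orbit hergodic hnonsingular hnotone)] with z hz hinj
  exact ⟨hz.1, S.compRep_irreducible ⟨z, hz.1⟩ hinj⟩
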